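/- Let $\mathcal V$ be a finite set of agents, let $\mathcal G$ be an undirected graph on $\mathcal V$ without loops, and let $\mathcal N_i$ be the set of neighbors of agent $i$. Consider the nonlinear program $$\min_{x}\ \sum_{i\in\mathcal V} f_i(x_i,x_{\mathcal N_i})\quad\text{s.t.}\quad g_i(x_i,x_{\mathcal N_i})=0,\quad h_i(x_i,x_{\mathcal N_i})\le 0\quad (i\in\mathcal V),\qquad(\mathrm{P})$$ with $x_i\in\mathbb R^{n_i}$, $x_{\mathcal N_i}=[x_j]_{j\in\mathcal N_i}$ and three times continuously differentiable $f_i,g_i,h_i$ with values in $\mathbb R,\mathbb R^{n_{gi}},\mathbb R^{n_{hi}}$. Let $L_i=f_i+\lambda_i^\top g_i+\mu_i^\top h_i$, $L=\sum_i L_i$, and $p=[x_i,\lambda_i,\mu_i]_{i\in\mathcal V}\in\mathbb R^{p}$. Norms are Euclidean and spectral norms, and $\mathcal B_r(p)$ is the closed ball of radius $r$ around $p$. One step of sensitivity-based distributed programming (SBDP) from $p$ to $q=[y_i,\lambda_i',\mu_i']_i$: every agent $i$ solves its local program $$\min_{y_i}\ f_i(y_i,x_{\mathcal N_i})+\sum_{j\in\mathcal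 N_i}\big(\nabla_{x_i}L_j(p)\big)^\top(y_i-x_i)\quad\text{s.t.}\quad g_i(y_i,x_{\mathcal N_i})=0,\ \ h_i(y_i,x_{\mathcal N_i})\le0,$$ that is, $y_i$ is a local minimizer that satisfies the KKT conditions of the local program with multipliers $\lambda_i',\mu_i'$. Algorithm 1 uses the gradients $\nabla_{x_i}L_j$. Algorithm 2 applies if (P) has neighbor-affine form, $f_i=f_{ii}(x_i)+\sum_{j\in\mathcal N_i}f_{ij}(x_i,x_j)$ and likewise for $g_i$, $h_i$ (all functions three times continuously differentiable), and uses $\nabla_{x_i}f_{ji}(x_j,x_i)+\nabla_{x_i}g_{ji}(x_j,x_i)^\top\lambda_j+\nabla_{x_i}h_{ji}(x_j,x_i)^\top\mu_j$ in their place. Let $\hat F(q,p)\in\mathbb R^p$ be the stack over $i$ of the left-hand sides of the local KKT equations (stationarity, $g_i=0$, $\operatorname{diag}(\mu_i')h_i=0$), and put $M=\nabla_q\hat F$, $N=\nabla_p\hat F$. Theorem. Let $p^*$ be a KKT point of (P) such that 1. strict complementarity, the second-order sufficient condition ($s^\top\nabla^2_{xx}L\,s>0$ for all $s\ne0$ in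 the kernel of the gradients of the equality constraints and of the active inequality constraints) and LICQ (these gradients are linearly independent) hold for (P) at $p^*$; 2. for every $i$, the second-order sufficient condition (with $\nabla^2_{x_ix_i}L_i$) and LICQ, both with respect to $x_i$ only, hold at $p^*$ for the local program of agent $i$ at $p^*$. Then there are $\rho,r_1>0$ and a map $\Phi:\mathbb R^p\to\mathbb R^p$ with $\Phi(p^*)=p^*$ such that for every $p\in\mathcal B_{r_1}(p^*)$ the point $\Phi(p)\in\mathcal B_\rho(p^*)$ is a solution of all local programs at $p$ in the above sense and the only point of $\mathcal B_\rho(p^*)$ that satisfies all their KKT conditions, the matrix $M(\Phi(p),p)$ is invertible, and $\Phi$ is differentiable at $p$ with Jacobian $J(p)=-M(\Phi(p),p)^{-1}N(\Phi(p),p)$. If moreover $\|J(p^*)\|<1$, then there are $0<r\le r_1$, $C\in(0,1)$ and $\tilde C<\infty$ such that, for Algorithm 1, and for Algorithm 2 if (P) is given in neighbor-affine form, every $p^0\in\mathcal B_r(p^*)$ is the start of a sequence of iterates with $p^q\in\mathcal B_\rho(p^*)$ for all $q\ge1$; and every such sequence satisfies $p^q=\Phi(p^{q-1})$, stays in $\mathcal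 B_r(p^*)$, converges to $p^*$, and for all $q\ge1$ (i) $\|p^q-p^*\|\le C\,\|p^{q-1}-p^*\|$; (ii) if $\|J(p^*)\|=0$, then also $\|p^q-p^*\|\le\tilde C\,\|p^{q-1}-p^*\|^2$. -/

import Mathlib

noncomputable section

namespace SBDP

/-- The Euclidean space `ℝ^k`. -/
abbrev Vec (k : ℕ) : Type := EuclideanSpace ℝ (Fin k)

section Setup

variable {V : Type*} [Fintype V] [DecidableEq V] {G : SimpleGraph V} [DecidableRel G.Adj]
  {n ng nh : V → ℕ}

/-- The Euclidean space of all stacked primal-dual vectors `p = [x_i, lam_i, mu_i]_i`. -/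
abbrev PDVec (n ng nh : V → ℕ) : Type _ :=
  EuclideanSpace ℝ (Σ i : V, Fin (n i) ⊕ Fin (ng i) ⊕ Fin (nh i))

/-- The block `x_i` of `p`. -/
def primal (p : PDVec n ng nh) (i : V) : Vec (n i) :=
  WithLp.toLp 2 fun k => p ⟨i, Sum.inl k⟩

/-- The block `lam_i` of `p`. -/
def eqMult (p : PDVec n ng nh) (i : V) : Vec (ng i) :=
  WithLp.toLp 2 fun k => p ⟨i, Sum.inr (Sum.inl k)⟩

/-- The block `mu_i` of `p`. -/
def ineqMult (p : PDVec n ng nh) (i : V) : Vec (nh i) :=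
  WithLp.toLp 2 fun k => p ⟨i, Sum.inr (Sum.inr k)⟩

/-- The gradient of `φ` with respect to the block `x_i`, at the point `x`. -/
def partialGradient (φ : (∀ i, Vec (n i)) → ℝ) (x : ∀ i, Vec (n i)) (i : V) : Vec (n i) :=
  gradient (fun y : Vec (n i) => φ (Function.update x i y)) (x i)

/-- The data of the central nonlinear program over the graph `G`:
minimize `∑ i, f i (x_i, x_{N_i})` subject to `g i (x_i, x_{N_i}) = 0` and
`h i (x_i, x_{N_i}) ≤ 0` for every agent `i`. -/
structure NLP (G : SimpleGraph V) (n ng nh : V → ℕ) where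
  f : ∀ i, Vec (n i) → (∀ j : G.neighborSet i, Vec (n j)) → ℝ
  g : ∀ i, Vec (n i) → (∀ j : G.neighborSet i, Vec (n j)) → Vec (ng i)
  h : ∀ i, Vec (n i) → (∀ j : G.neighborSet i, Vec (n j)) → Vec (nh i)

namespace NLP

/-- All functions of the program are three times continuously differentiable (jointly). -/
structure IsSmooth (P : NLP G n ng nh) : Prop where
  f : ∀ i, ContDiff ℝ 3
    (fun z : Vec (n i) × (∀ j : G.neighborSet i, Vec (n j)) => P.f i z.1 z.2)
  g : ∀ i, ContDiff ℝ 3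
    (fun z : Vec (n i) × (∀ j : G.neighborSet i, Vec (n j)) => P.g i z.1 z.2)
  h : ∀ i, ContDiff ℝ 3
    (fun z : Vec (n i) × (∀ j : G.neighborSet i, Vec (n j)) => P.h i z.1 z.2)

variable (P : NLP G n ng nh)

/-- `f_i` as a function of the whole vector `x`. -/
def fAt (i : V) (x : ∀ i, Vec (n i)) : ℝ := P.f i (x i) fun j => x j

/-- `g_i` as a function of the whole vector `x`. -/
def gAt (i : V) (x : ∀ i, Vec (n i)) : Vec (ng i) := P.g i (x i) fun j => x j

/-- `h_i` as a function of the whole vector `x`. -/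
def hAt (i : V) (x : ∀ i, Vec (n i)) : Vec (nh i) := P.h i (x i) fun j => x j

/-- The local Lagrangian `L_i = f_i + lam_iᵀ g_i + mu_iᵀ h_i`. -/
def localLagrangian (i : V) (x : ∀ i, Vec (n i)) (lam : Vec (ng i)) (mu : Vec (nh i)) : ℝ :=
  P.fAt i x + inner ℝ lam (P.gAt i x) + inner ℝ mu (P.hAt i x)

/-- The central Lagrangian `L = ∑ i, L_i`. -/
def lagrangian (x : ∀ i, Vec (n i)) (lam : ∀ i, Vec (ng i)) (mu : ∀ i, Vec (nh i)) : ℝ :=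
  ∑ i, P.localLagrangian i x (lam i) (mu i)

/-- `p` is a KKT point of the central program. -/
structure IsCentralKKT (p : PDVec n ng nh) : Prop where
  stationary : ∀ i,
    partialGradient (fun x => P.lagrangian x (eqMult p) (ineqMult p)) (primal p) i = 0
  eq_feasible : ∀ i, P.gAt i (primal p) = 0
  compl : ∀ i k, ineqMult p i k * P.hAt i (primal p) k = 0
  ineq_feasible : ∀ i k, P.hAt i (primal p) k ≤ 0
  mult_nonneg : ∀ i k, 0 ≤ ineqMult p i k

/-- Strict complementarity, second-order sufficient conditions, and linear independence of the
gradients of the equality constraints and of the active inequality constraints, for the central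
program at `p`. -/
structure CentralRegularity (p : PDVec n ng nh) : Prop where
  strict_compl : ∀ i k, P.hAt i (primal p) k = 0 → 0 < ineqMult p i k
  sosc : ∀ s : (∀ i, Vec (n i)), s ≠ 0 →
    (∀ i, fderiv ℝ (P.gAt i) (primal p) s = 0) →
    (∀ i k, P.hAt i (primal p) k = 0 → fderiv ℝ (fun x => P.hAt i x k) (primal p) s = 0) →
    0 < fderiv ℝ (fderiv ℝ fun x => P.lagrangian x (eqMult p) (ineqMult p)) (primal p) s s
  licq : LinearIndependent ℝ
    (Sum.elim
      (fun a : Σ i, Fin (ng i) => fderiv ℝ (fun x => P.gAt a.1 x a.2) (primal p))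
      (fun a : {a : Σ i, Fin (nh i) // P.hAt a.1 (primal p) a.2 = 0} =>
        fderiv ℝ (fun x => P.hAt a.1.1 x a.1.2) (primal p)))

/-- Second-order sufficient conditions and linear independence of the gradients of the equality
constraints and of the active inequality constraints, with respect to `x_i` only, for the local
program of every agent `i`, at `p`. -/
structure LocalRegularity (p : PDVec n ng nh) : Prop where
  sosc : ∀ i, ∀ s : Vec (n i), s ≠ 0 →
    fderiv ℝ (fun y => P.gAt i (Function.update (primal p) i y)) (primal p i) s = 0 →
    (∀ k, P.hAt i (primal p) k = 0 →
      fderiv ℝ (fun y => P.hAt i (Function.update (primal p) i y) k) (primal p i) s = 0) →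
    0 < fderiv ℝ (fderiv ℝ fun y => P.localLagrangian i (Function.update (primal p) i y)
      (eqMult p i) (ineqMult p i)) (primal p i) s s
  licq : ∀ i, LinearIndependent ℝ
    (Sum.elim
      (fun k : Fin (ng i) =>
        fderiv ℝ (fun y => P.gAt i (Function.update (primal p) i y) k) (primal p i))
      (fun k : {k : Fin (nh i) // P.hAt i (primal p) k = 0} =>
        fderiv ℝ (fun y => P.hAt i (Function.update (primal p) i y) k) (primal p i)))

/-- The sensitivity `∇_{x_i} L_j` evaluated at the iterate `p`. -/
def sensitivity (p : PDVec n ng nh) (i j : V) : Vec (n i) :=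
  partialGradient (fun x => P.localLagrangian j x (eqMult p j) (ineqMult p j)) (primal p) i

/-- The point whose `i`-th block is `y` and whose other blocks come from the iterate `p`. -/
def mixed (p : PDVec n ng nh) (i : V) (y : Vec (n i)) : ∀ i, Vec (n i) :=
  Function.update (primal p) i y

/-- The objective of the local program of agent `i` at the iterate `p`, where `s j` is the
sensitivity received for the neighbor `j`. -/
def localObjective (p : PDVec n ng nh) (i : V) (s : G.neighborSet i → Vec (n i))
    (y : Vec (n i)) : ℝ :=
  P.fAt i (mixed p i y) + ∑ j, inner ℝ (s j) (y - primal p i)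

/-- The feasible set of the local program of agent `i` at the iterate `p`. -/
def localFeasible (p : PDVec n ng nh) (i : V) : Set (Vec (n i)) :=
  {y | P.gAt i (mixed p i y) = 0 ∧ ∀ k, P.hAt i (mixed p i y) k ≤ 0}

/-- `(y, lam, mu)` is a KKT point of the local program of agent `i` at the iterate `p`. -/
structure IsLocalKKT (p : PDVec n ng nh) (i : V) (s : G.neighborSet i → Vec (n i))
    (y : Vec (n i)) (lam : Vec (ng i)) (mu : Vec (nh i)) : Prop where
  stationary :
    partialGradient (fun x => P.localLagrangian i x lam mu) (mixed p i y) i + ∑ j, s j = 0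
  eq_feasible : P.gAt i (mixed p i y) = 0
  compl : ∀ k, mu k * P.hAt i (mixed p i y) k = 0
  ineq_feasible : ∀ k, P.hAt i (mixed p i y) k ≤ 0
  mult_nonneg : ∀ k, 0 ≤ mu k

/-- `q` solves all local programs at the iterate `p`, with sensitivities `s`: for every agent `i`
its primal block is a local minimizer, with its dual blocks as Lagrange multipliers. -/
def SolvesLocal (p : PDVec n ng nh) (s : ∀ i, G.neighborSet i → Vec (n i))
    (q : PDVec n ng nh) : Prop :=
  ∀ i, IsLocalMinOn (P.localObjective p i (s i)) (P.localFeasible p i) (primal q i) ∧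
    P.IsLocalKKT p i (s i) (primal q i) (eqMult q i) (ineqMult q i)

/-- The general SBDP algorithm: in iteration `k`, agent `j` computes the gradients
`∇_{x_i} L_j` at the current iterate and sends them to its neighbors `i`; then every agent
solves its local program. -/
def IsGeneralSBDP (p : ℕ → PDVec n ng nh) : Prop :=
  ∀ k, P.SolvesLocal (p k) (fun i j => P.sensitivity (p k) i j) (p (k + 1))

/-- The map `F̂ (q, p)` that collects the equalities of the local KKT conditions of all agents,
at the unknown `q` and the previous iterate `p`. -/
def kktMap (q p : PDVec n ng nh) : PDVec n ng nh :=
  WithLp.toLp 2 fun a => match a with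
    | ⟨i, Sum.inl k⟩ =>
      (partialGradient (fun x => P.localLagrangian i x (eqMult q i) (ineqMult q i))
        (mixed p i (primal q i)) i + ∑ j : G.neighborSet i, P.sensitivity p i j) k
    | ⟨i, Sum.inr (Sum.inl k)⟩ => P.gAt i (mixed p i (primal q i)) k
    | ⟨i, Sum.inr (Sum.inr k)⟩ => ineqMult q i k * P.hAt i (mixed p i (primal q i)) k

/-- `M = ∇_q F̂ (q, p)`. -/
def matM (q p : PDVec n ng nh) : PDVec n ng nh →L[ℝ] PDVec n ng nh :=
  fderiv ℝ (fun q' => P.kktMap q' p) q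

/-- `N = ∇_p F̂ (q, p)`. -/
def matN (q p : PDVec n ng nh) : PDVec n ng nh →L[ℝ] PDVec n ng nh :=
  fderiv ℝ (fun p' => P.kktMap q p') p

/-- `J = - M⁻¹ N`, as an operator on the Euclidean space of primal-dual vectors. -/
def jacobian (q p : PDVec n ng nh) : PDVec n ng nh →L[ℝ] PDVec n ng nh :=
  -((P.matM q p).inverse ∘L P.matN q p)

end NLP

/-- The data of a program in neighbor-affine form:
`f_i = f_ii (x_i) + ∑ j ∈ N_i, f_ij (x_i, x_j)`, and likewise for `g_i` and `h_i`. -/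
structure NeighborAffine (G : SimpleGraph V) (n ng nh : V → ℕ) where
  fOwn : ∀ i, Vec (n i) → ℝ
  gOwn : ∀ i, Vec (n i) → Vec (ng i)
  hOwn : ∀ i, Vec (n i) → Vec (nh i)
  fCpl : ∀ i, ∀ j : G.neighborSet i, Vec (n i) → Vec (n j) → ℝ
  gCpl : ∀ i, ∀ j : G.neighborSet i, Vec (n i) → Vec (n j) → Vec (ng i)
  hCpl : ∀ i, ∀ j : G.neighborSet i, Vec (n i) → Vec (n j) → Vec (nh i)

namespace NeighborAffine

/-- All functions of the neighbor-affine form are three times continuously differentiable. -/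
structure IsSmooth (D : NeighborAffine G n ng nh) : Prop where
  fOwn : ∀ i, ContDiff ℝ 3 (D.fOwn i)
  gOwn : ∀ i, ContDiff ℝ 3 (D.gOwn i)
  hOwn : ∀ i, ContDiff ℝ 3 (D.hOwn i)
  fCpl : ∀ i, ∀ j : G.neighborSet i,
    ContDiff ℝ 3 (fun z : Vec (n i) × Vec (n j) => D.fCpl i j z.1 z.2)
  gCpl : ∀ i, ∀ j : G.neighborSet i,
    ContDiff ℝ 3 (fun z : Vec (n i) × Vec (n j) => D.gCpl i j z.1 z.2)
  hCpl : ∀ i, ∀ j : G.neighborSet i,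
    ContDiff ℝ 3 (fun z : Vec (n i) × Vec (n j) => D.hCpl i j z.1 z.2)

variable (D : NeighborAffine G n ng nh)

/-- The central program given by the neighbor-affine data. -/
def toNLP : NLP G n ng nh where
  f i y z := D.fOwn i y + ∑ j, D.fCpl i j y (z j)
  g i y z := D.gOwn i y + ∑ j, D.gCpl i j y (z j)
  h i y z := D.hOwn i y + ∑ j, D.hCpl i j y (z j)

/-- The sensitivity of the neighbor `j` of agent `i`, as agent `i` computes it from its own and
its neighbors' variables:
`∇_{x_i} f_ji (x_j, x_i) + ∇_{x_i} g_ji (x_j, x_i)ᵀ lam_j + ∇_{x_i} h_ji (x_j, x_i)ᵀ mu_j`. -/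
def sensitivity (p : PDVec n ng nh) (i : V) (j : G.neighborSet i) : Vec (n i) :=
  have hji : i ∈ G.neighborSet j := G.adj_symm j.2
  gradient (fun y => D.fCpl j ⟨i, hji⟩ (primal p j) y) (primal p i) +
    (fderiv ℝ (fun y => D.gCpl j ⟨i, hji⟩ (primal p j) y) (primal p i)).adjoint (eqMult p j) +
    (fderiv ℝ (fun y => D.hCpl j ⟨i, hji⟩ (primal p j) y) (primal p i)).adjoint (ineqMult p j)

/-- The neighbor-affine SBDP algorithm: the agents exchange `x`, `lam`, `mu`, and every agent
computes the sensitivities of its neighbors itself and then solves its local program. -/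
def IsAffineSBDP (p : ℕ → PDVec n ng nh) : Prop :=
  ∀ k, D.toNLP.SolvesLocal (p k) (fun i j => D.sensitivity (p k) i j) (p (k + 1))

end NeighborAffine

/-- `p` is a sequence of iterates, for the program `P`, of the general SBDP algorithm, or of the
neighbor-affine SBDP algorithm for some neighbor-affine form of `P`. -/
def NLP.IsSBDP (P : NLP G n ng nh) (p : ℕ → PDVec n ng nh) : Prop :=
  P.IsGeneralSBDP p ∨
    ∃ D : NeighborAffine G n ng nh, D.IsSmooth ∧ D.toNLP = P ∧ D.IsAffineSBDP p

end Setup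

end SBDP

end

open Filter Topology Metric Set

set_option linter.unusedSectionVars false

/-! Near `pstar` one step of the algorithm is the implicit function `Φ` of the equation `kktMap q p
= 0`, and the convergence statement is a fixed-point estimate for `Φ`.

Loops are absent and `L_j` involves only the blocks of `j` and its neighbors, so the central
stationarity condition in `x_i` is the local one at `q = p = pstar`. Hence `kktMap pstar pstar = 0`
(`kktMap_self`). The map `q ↦ kktMap q p` decouples over the agents. With strict complementarity,
each block of its derivative is a nonsingular KKT matrix by the local second-order condition and
LICQ (`matM_injective`). `exists_implicit_map` then gives `Φ`, its Jacobian and uniqueness on a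
whole ball.

A zero of the KKT equations need not be a minimizer. `eventually_solvesLocal` shows that it is one
near `pstar`. Strict complementarity preserves the signs of the active multipliers and of the
inactive constraints, and an augmented Lagrangian, convex near the solution uniformly in the
parameters, gives local minimality.

Finally `Φ` is `C²` and fixes `pstar`: a derivative of norm less than one gives linear contraction,
and a vanishing derivative gives a quadratic estimate (`exists_contraction_estimate`). Algorithm 2
exchanges the same sensitivities as Algorithm 1, so it needs no separate analysis. -/

/-! ### Abstract analysis: penalization, implicit functions, contraction -/

/-- Finsler's lemma by compactness: the open sets where `Q + m R > 1 / (m + 1)` increase with `m`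
and cover the unit sphere, so one of them contains it. The same `m` supplies both constants, and
homogeneity extends the bound to all vectors. -/
theorem exists_coercive_add_mul {E : Type*} [NormedAddCommGroup E] [NormedSpace ℝ E]
    [FiniteDimensional ℝ E] {Q R : E → ℝ} (hQ : Continuous Q) (hR : Continuous R)
    (hQ2 : ∀ (t : ℝ) s, Q (t • s) = t ^ 2 * Q s) (hR2 : ∀ (t : ℝ) s, R (t • s) = t ^ 2 * R s)
    (hR0 : ∀ s, 0 ≤ R s) (h : ∀ s, s ≠ 0 → R s = 0 → 0 < Q s) :
    ∃ c ≥ 0, ∃ α > 0, ∀ s, α * ‖s‖ ^ 2 ≤ Q s + c * R s := by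
  obtain ⟨m, hm⟩ := (isCompact_sphere (0 : E) 1).elim_directed_cover
    (fun m : ℕ => {s | (1 : ℝ) / (m + 1) < Q s + m * R s})
    (fun m => isOpen_lt continuous_const (by fun_prop)) (by
      intro s hs
      have hs0 : s ≠ 0 := by rintro rfl; simp at hs
      simp only [mem_iUnion, mem_ofPred_eq]
      rcases (hR0 s).eq_or_lt with h0 | h0
      · obtain ⟨m, hm⟩ := exists_nat_one_div_lt (h s hs0 h0.symm)
        exact ⟨m, by simpa [← h0] using hm⟩
      · obtain ⟨m, hm⟩ := exists_nat_gt ((1 - Q s) / R s)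
        rw [div_lt_iff₀ h0] at hm
        have : (1 : ℝ) / (m + 1) ≤ 1 := by
          rw [div_le_one (by positivity)]; linarith [(Nat.cast_nonneg m : (0 : ℝ) ≤ m)]
        exact ⟨m, by linarith⟩)
    (directed_of_isDirected_le (by
      intro m k hmk s hs
      simp only [mem_ofPred_eq] at hs ⊢
      have h1 : (m : ℝ) ≤ k := by exact_mod_cast hmk
      have h2 : (1 : ℝ) / (k + 1) ≤ 1 / (m + 1) := by gcongr
      nlinarith [hR0 s]))
  refine ⟨m, by positivity, 1 / (m + 1), by positivity, fun s => ?_⟩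
  rcases eq_or_ne s 0 with rfl | hs
  · have h1 := hQ2 0 0
    have h2 := hR2 0 0
    simp at h1 h2
    simp [h1, h2]
  · have hn : ‖s‖ ≠ 0 := by simpa using hs
    have h1 := hm (show ‖s‖⁻¹ • s ∈ sphere (0 : E) 1 by simp [norm_smul, hn])
    simp only [mem_ofPred_eq, hQ2, hR2] at h1
    have h3 : Q s + m * R s = ‖s‖ ^ 2 * (‖s‖⁻¹ ^ 2 * Q s + m * (‖s‖⁻¹ ^ 2 * R s)) := by
      field_simp
    rw [h3, mul_comm]
    gcongr

/-- The penalty makes the Hessian of the augmented function positive definite at `(θ₀, y₀)`. Strict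
differentiability of its gradient spreads this to one ball that serves all parameters, and there a
critical point minimizes along every segment issuing from it. -/
theorem exists_augmented_min {E Θ ι : Type*} [NormedAddCommGroup E] [NormedSpace ℝ E]
    [FiniteDimensional ℝ E] [NormedAddCommGroup Θ] [NormedSpace ℝ Θ] [Fintype ι]
    {l : Θ → E → ℝ} {u : ι → Θ → E → ℝ}
    (hl : ContDiff ℝ 2 (Function.uncurry l)) (hu : ∀ a, ContDiff ℝ 2 (Function.uncurry (u a)))
    (θ₀ : Θ) (y₀ : E) (hu0 : ∀ a, u a θ₀ y₀ = 0)
    (hpos : ∀ s, s ≠ 0 → (∀ a, fderiv ℝ (u a θ₀) y₀ s = 0) →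
      0 < fderiv ℝ (fderiv ℝ (l θ₀)) y₀ s s) :
    ∃ c ≥ 0, ∃ δ > 0, ∀ θ ∈ ball θ₀ δ, ∀ y₁ ∈ ball y₀ δ, fderiv ℝ (l θ) y₁ = 0 →
      (∀ a, u a θ y₁ = 0) → ∀ y ∈ ball y₀ δ, l θ y₁ ≤ l θ y + c * ∑ a, u a θ y ^ 2 := by
  have hlθ : ∀ θ, ContDiff ℝ 2 (l θ) := fun θ => hl.comp (contDiff_const.prodMk contDiff_id)
  have huθ : ∀ a θ, ContDiff ℝ 2 (u a θ) :=
    fun a θ => (hu a).comp (contDiff_const.prodMk contDiff_id)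
  obtain ⟨c, hc, α, hα, hcα⟩ := exists_coercive_add_mul
    (Q := fun s => fderiv ℝ (fderiv ℝ (l θ₀)) y₀ s s)
    (R := fun s => ∑ a, (fderiv ℝ (u a θ₀) y₀ s) ^ 2) (by fun_prop) (by fun_prop)
    (by intro t s; simp; ring)
    (by intro t s; simp [mul_pow, Finset.mul_sum])
    (fun s => Finset.sum_nonneg fun a _ => sq_nonneg _)
    (by
      intro s hs h0
      refine hpos s hs fun a => ?_
      rw [Finset.sum_eq_zero_iff_of_nonneg (fun a _ => sq_nonneg _)] at h0
      simpa using h0 a (Finset.mem_univ a))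
  -- `D` is the `y`-derivative of `l + (c / 2) * ∑ a, u a ^ 2`; hence the final constant is `c / 2`.
  set D : Θ × E → (E →L[ℝ] ℝ) := fun x =>
    fderiv ℝ (l x.1) x.2 + c • ∑ a, u a x.1 x.2 • fderiv ℝ (u a x.1) x.2 with hD
  have hdl : ContDiff ℝ 1 (fun x : Θ × E => fderiv ℝ (l x.1) x.2) := by
    refine ContDiff.fderiv (m := 2) (f := fun x : Θ × E => l x.1) ?_ contDiff_snd (by norm_num)
    exact hl.comp ((contDiff_fst.comp contDiff_fst).prodMk contDiff_snd)
  have hdu : ∀ a, ContDiff ℝ 1 (fun x : Θ × E => fderiv ℝ (u a x.1) x.2) := by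
    intro a
    refine ContDiff.fderiv (m := 2) (f := fun x : Θ × E => u a x.1) ?_ contDiff_snd (by norm_num)
    exact (hu a).comp ((contDiff_fst.comp contDiff_fst).prodMk contDiff_snd)
  have hDc : ContDiff ℝ 1 D := by
    refine hdl.add (ContDiff.const_smul c (ContDiff.sum fun a _ => ContDiff.fun_smul ?_ (hdu a)))
    exact (hu a).of_le (by norm_num)
  have hs := hDc.contDiffAt.hasStrictFDerivAt (x := (θ₀, y₀)) (by norm_num)
  -- Since each `u a` vanishes at the base point, its second derivative drops out and the penalty
  -- contributes only the squares of the first derivatives.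
  have hB : ∀ s, α * ‖s‖ ^ 2 ≤ fderiv ℝ D (θ₀, y₀) (0, s) s := by
    intro s
    have h1 : HasFDerivAt (fun y => D (θ₀, y)) (fderiv ℝ D (θ₀, y₀) ∘L .inr ℝ Θ E) y₀ :=
      hs.hasFDerivAt.comp y₀ (hasFDerivAt_prodMk_right θ₀ y₀)
    have h2 : HasFDerivAt (fun y => D (θ₀, y))
        (fderiv ℝ (fderiv ℝ (l θ₀)) y₀ + c • ∑ a, (u a θ₀ y₀ • fderiv ℝ (fderiv ℝ (u a θ₀)) y₀ +
          (fderiv ℝ (u a θ₀) y₀).smulRight (fderiv ℝ (u a θ₀) y₀))) y₀ := by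
      have e1 := (((hlθ θ₀).fderiv_right (m := 1) (by norm_num)).differentiable (by norm_num)
        y₀).hasFDerivAt
      have e2 := fun a => ((huθ a θ₀).differentiable (by norm_num) y₀).hasFDerivAt
      have e3 := fun a => (((huθ a θ₀).fderiv_right (m := 1) (by norm_num)).differentiable
        (by norm_num) y₀).hasFDerivAt
      exact e1.add ((HasFDerivAt.fun_sum (u := Finset.univ) fun a _ =>
        (e2 a).fun_smul (e3 a)).const_smul c)
    have h3 := congrArg (fun T => T s s) (h1.unique h2)
    simp [hu0] at h3
    rw [h3]
    simpa [sq] using hcα s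
  -- Error `α / 2` against coercivity `α` leaves `D (θ, ·)` monotone; the two points compared will
  -- share the same `θ`, so only the `y`-increment remains.
  have hev := (hs.isLittleO).def (half_pos hα)
  rw [nhds_prod_eq, eventually_prod_self_iff (r := fun x y => ‖D x - D y - fderiv ℝ D (θ₀, y₀)
    (x - y)‖ ≤ α / 2 * ‖x - y‖)] at hev
  obtain ⟨t, ht, hev⟩ := hev
  obtain ⟨δ, hδ, hδt⟩ := Metric.mem_nhds_iff.1 ht
  refine ⟨c / 2, by positivity, δ, hδ, fun θ hθ y₁ hy₁ hd hu1 y hy => ?_⟩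
  have hD1 : D (θ, y₁) = 0 := by simp [hD, hd, hu1]
  have key : ∀ z ∈ ball y₀ δ, 0 ≤ D (θ, z) (z - y₁) := by
    intro z hz
    have h1 := hev (θ, z) (hδt (by rw [← ball_prod_same]; exact ⟨hθ, hz⟩)) (θ, y₁)
      (hδt (by rw [← ball_prod_same]; exact ⟨hθ, hy₁⟩))
    rw [hD1] at h1
    simp only [sub_zero, Prod.mk_sub_mk, sub_self, Prod.norm_mk, norm_zero] at h1
    rw [max_eq_right (norm_nonneg _)] at h1
    have h2 := (D (θ, z) - fderiv ℝ D (θ₀, y₀) (0, z - y₁)).le_opNorm (z - y₁)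
    have h3 := hB (z - y₁)
    rw [Real.norm_eq_abs, sub_apply] at h2
    have h4 := neg_abs_le (D (θ, z) (z - y₁) - fderiv ℝ D (θ₀, y₀) (0, z - y₁) (z - y₁))
    have h5 := mul_le_mul_of_nonneg_right h1 (norm_nonneg (z - y₁))
    nlinarith [sq_nonneg ‖z - y₁‖]
  set φ : ℝ → ℝ := fun t => l θ (y₁ + t • (y - y₁)) +
    c / 2 * ∑ a, u a θ (y₁ + t • (y - y₁)) ^ 2 with hφ
  have hφ' : ∀ t, HasDerivAt φ (D (θ, y₁ + t • (y - y₁)) (y - y₁)) t := by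
    intro t
    have hline : HasDerivAt (fun t : ℝ => y₁ + t • (y - y₁)) (y - y₁) t := by
      simpa using ((hasDerivAt_id t).smul_const (y - y₁)).const_add y₁
    have e1 := ((hlθ θ).differentiable (by norm_num) (y₁ + t • (y - y₁))).hasFDerivAt.comp_hasDerivAt
      t hline
    have e2 := fun a => (((huθ a θ).differentiable (by norm_num)
      (y₁ + t • (y - y₁))).hasFDerivAt.comp_hasDerivAt t hline).pow 2
    have e3 := e1.add ((HasDerivAt.fun_sum (u := Finset.univ) fun a _ => e2 a).const_mul (c / 2))
    refine e3.congr_deriv ?_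
    simp [hD, Finset.mul_sum]
    refine Finset.sum_congr rfl fun a _ => by ring
  have hmono : MonotoneOn φ (Icc 0 1) := by
    refine monotoneOn_of_deriv_nonneg (convex_Icc 0 1)
      (fun t _ => (hφ' t).continuousAt.continuousWithinAt)
      (fun t _ => (hφ' t).differentiableAt.differentiableWithinAt) fun t ht => ?_
    rw [interior_Icc] at ht
    rw [(hφ' t).deriv]
    have h1 := key (y₁ + t • (y - y₁)) ((convex_ball y₀ δ).add_smul_sub_mem hy₁ hy
      ⟨ht.1.le, ht.2.le⟩)
    simp only [add_sub_cancel_left, map_smul, smul_eq_mul] at h1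
    -- The increment from `y₁` is `t • (y - y₁)`; dividing by `t > 0` gives the sign of the
    -- derivative of `φ`.
    exact nonneg_of_mul_nonneg_right h1 ht.1
  have := hmono (left_mem_Icc.2 zero_le_one) (right_mem_Icc.2 zero_le_one) zero_le_one
  simpa [hφ, hu1] using this

/-- This is the implicit function theorem with its conclusions made uniform on closed balls; `W`
carries any further property needed near the base point. -/
theorem exists_implicit_map {E P : Type*} [NormedAddCommGroup E] [NormedSpace ℝ E]
    [CompleteSpace E] [NormedAddCommGroup P] [NormedSpace ℝ P] [CompleteSpace P] {F : E → P → E}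
    (hF : ContDiff ℝ 2 (Function.uncurry F)) {q₀ : E} {p₀ : P} (h0 : F q₀ p₀ = 0)
    (hM : (fderiv ℝ (fun q => F q p₀) q₀).IsInvertible) {W : Set (E × P)}
    (hW : W ∈ 𝓝 (q₀, p₀)) :
    ∃ ρ > 0, ∃ r > 0, ∃ Φ : P → E, Φ p₀ = q₀ ∧ ContDiffAt ℝ 2 Φ p₀ ∧
      closedBall q₀ ρ ×ˢ closedBall p₀ r ⊆ W ∧
      ∀ p ∈ closedBall p₀ r, Φ p ∈ closedBall q₀ ρ ∧
        (∀ q ∈ closedBall q₀ ρ, F q p = 0 ↔ q = Φ p) ∧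
        (fderiv ℝ (fun q => F q p) (Φ p)).IsInvertible ∧
        HasFDerivAt Φ (-((fderiv ℝ (fun q => F q p) (Φ p)).inverse ∘L
          fderiv ℝ (fun p' => F (Φ p) p') p)) p := by
  set F' : P × E → E := fun x => F x.2 x.1 with hF'
  have hF'c : ContDiff ℝ 2 F' := hF.comp (contDiff_snd.prodMk contDiff_fst)
  have hdiff : ∀ x, DifferentiableAt ℝ F' x := hF'c.differentiable (by norm_num)
  have hdq : ∀ q p, fderiv ℝ (fun q => F q p) q = fderiv ℝ F' (p, q) ∘L .inr ℝ P E := by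
    intro q p
    exact ((hdiff (p, q)).hasFDerivAt.comp q (hasFDerivAt_prodMk_right p q)).fderiv
  have hdp : ∀ q p, fderiv ℝ (fun p => F q p) p = fderiv ℝ F' (p, q) ∘L .inl ℝ P E := by
    intro q p
    exact (HasFDerivAt.comp (g := F') p (hdiff (p, q)).hasFDerivAt
      (hasFDerivAt_prodMk_left (𝕜 := ℝ) p q)).fderiv
  have hinv : (fderiv ℝ F' (p₀, q₀) ∘L .inr ℝ P E).IsInvertible := hdq q₀ p₀ ▸ hM
  have hat : ContDiffAt ℝ 2 F' (p₀, q₀) := hF'c.contDiffAt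
  set Φ := hat.implicitFunction two_ne_zero hinv with hΦ
  have hΦ0 : Φ p₀ = q₀ := hat.implicitFunction_apply_self two_ne_zero hinv
  have hΦc : ContDiffAt ℝ 2 Φ p₀ := hat.contDiffAt_implicitFunction two_ne_zero hinv
  have ev1 := hat.eventually_apply_eq_iff_implicitFunction two_ne_zero hinv
  have ev2 : ∀ᶠ x in 𝓝 (p₀, q₀), (fderiv ℝ F' x ∘L .inr ℝ P E).IsInvertible := by
    have hc : Continuous fun x => fderiv ℝ F' x ∘L .inr ℝ P E :=
      (hF'c.continuous_fderiv (by norm_num)).clm_comp continuous_const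
    obtain ⟨e, he⟩ := hinv
    have := hc.continuousAt.preimage_mem_nhds (he ▸ e.nhds)
    filter_upwards [this] with x hx
    exact hx
  have ev3 : ∀ᶠ x in 𝓝 (p₀, q₀), (x.2, x.1) ∈ W :=
    (continuous_snd.prodMk continuous_fst).continuousAt.preimage_mem_nhds hW
  obtain ⟨ρ', hρ', hρ⟩ := Metric.nhds_basis_closedBall.mem_iff.1 ((ev1.and ev2).and ev3)
  have ev4 : ∀ᶠ p in 𝓝 p₀, Φ p ∈ closedBall q₀ ρ' :=
    hΦc.continuousAt.preimage_mem_nhds (by rw [hΦ0]; exact closedBall_mem_nhds _ hρ')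
  have ev5 : ∀ᶠ p in 𝓝 p₀, ContDiffAt ℝ 2 Φ p := hΦc.eventually (by simp)
  have ev6 : ∀ᶠ p in 𝓝 p₀, F (Φ p) p = 0 := by
    have := hat.eventually_apply_implicitFunction two_ne_zero hinv
    filter_upwards [this] with p hp
    exact hp.trans h0
  -- The equation is required on a neighborhood of each `p`, so that it can be differentiated at
  -- every point of the ball.
  obtain ⟨r', hr', hr⟩ := Metric.nhds_basis_closedBall.mem_iff.1
    ((ev4.and ev5).and ev6.eventually_nhds)
  have hmem : ∀ q ∈ closedBall q₀ ρ', ∀ p ∈ closedBall p₀ (min ρ' r'),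
      (p, q) ∈ closedBall (p₀, q₀) ρ' := by
    intro q hq p hp
    rw [← closedBall_prod_same]
    exact ⟨closedBall_subset_closedBall (min_le_left _ _) hp, hq⟩
  refine ⟨ρ', hρ', min ρ' r', lt_min hρ' hr', Φ, hΦ0, hΦc, ?_, ?_⟩
  · rintro ⟨q, p⟩ ⟨hq, hp⟩
    exact (hρ (hmem q hq p hp)).2
  · intro p hp
    obtain ⟨⟨h4, h5⟩, h6⟩ := hr (closedBall_subset_closedBall (min_le_right _ _) hp)
    have hi := (hρ (hmem _ h4 p hp)).1.2
    refine ⟨h4, fun q hq => ?_, hdq _ _ ▸ hi, ?_⟩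
    · have := (hρ (hmem q hq p hp)).1.1
      simp only [hF', h0] at this
      rw [this, eq_comm]
    · have hd : HasFDerivAt Φ (fderiv ℝ Φ p) p := (h5.differentiableAt (by norm_num)).hasFDerivAt
      have h7 : HasFDerivAt (fun p => F (Φ p) p)
          (fderiv ℝ F' (p, Φ p) ∘L (ContinuousLinearMap.id ℝ P).prod (fderiv ℝ Φ p)) p :=
        HasFDerivAt.comp (g := F') p (hdiff (p, Φ p)).hasFDerivAt ((hasFDerivAt_id p).prodMk hd)
      have h8 : HasFDerivAt (fun p => F (Φ p) p) (0 : P →L[ℝ] E) p :=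
        (hasFDerivAt_const 0 p).congr_of_eventuallyEq h6
      have h9 := h7.unique h8
      convert hd using 1
      rw [hdq, hdp]
      ext v
      have h10 : fderiv ℝ F' (p, Φ p) (v, fderiv ℝ Φ p v) = 0 :=
        congrArg (fun T => T v) h9
      have h11 : fderiv ℝ F' (p, Φ p) (v, 0) + fderiv ℝ F' (p, Φ p) (0, fderiv ℝ Φ p v) = 0 := by
        rw [← map_add]; simpa using h10
      simp only [neg_apply, ContinuousLinearMap.comp_apply]
      rw [← map_neg, hi.inverse_apply_eq]
      simpa using (eq_neg_of_add_eq_zero_right h11).symm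

/-- Any `C` strictly between the derivative norm and `1` absorbs the first-order error. If the
derivative vanishes at `p₀`, its local Lipschitz constant `K` bounds it by `K * ‖p - p₀‖` on the
ball of radius `‖p - p₀‖`, and the mean value inequality gives the square. -/
theorem exists_contraction_estimate {E : Type*} [NormedAddCommGroup E] [NormedSpace ℝ E]
    {Φ : E → E} {p₀ : E} (hΦ : ContDiffAt ℝ 2 Φ p₀) (h0 : Φ p₀ = p₀)
    (hJ : ‖fderiv ℝ Φ p₀‖ < 1) {r₁ : ℝ} (hr₁ : 0 < r₁) :
    ∃ r > 0, r ≤ r₁ ∧ ∃ C C' : ℝ, 0 < C ∧ C < 1 ∧ ∀ p ∈ closedBall p₀ r,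
      ‖Φ p - p₀‖ ≤ C * ‖p - p₀‖ ∧ (‖fderiv ℝ Φ p₀‖ = 0 → ‖Φ p - p₀‖ ≤ C' * ‖p - p₀‖ ^ 2) := by
  obtain ⟨C, hC0, hC1⟩ := exists_between hJ
  have hCpos : 0 < C := (norm_nonneg _).trans_lt hC0
  have hdiff := hΦ.differentiableAt (by norm_num)
  have ev1 : ∀ᶠ p in 𝓝 p₀, ‖Φ p - p₀‖ ≤ C * ‖p - p₀‖ := by
    have := hdiff.hasFDerivAt.isLittleO.def (sub_pos.2 hC0)
    filter_upwards [this] with p hp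
    rw [h0] at hp
    have h1 := (fderiv ℝ Φ p₀).le_opNorm (p - p₀)
    have h2 := norm_add_le (Φ p - p₀ - fderiv ℝ Φ p₀ (p - p₀)) (fderiv ℝ Φ p₀ (p - p₀))
    rw [sub_add_cancel] at h2
    nlinarith
  obtain ⟨K, t, ht, hK⟩ := (hΦ.fderiv_right (m := 1) (by norm_num)).exists_lipschitzOnWith
  have ev2 : ∀ᶠ p in 𝓝 p₀, ContDiffAt ℝ 2 Φ p := hΦ.eventually (by simp)
  obtain ⟨r, hr, hrs⟩ := Metric.nhds_basis_closedBall.mem_iff.1 ((ev1.and ev2).and ht)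
  refine ⟨min r r₁, lt_min hr hr₁, min_le_right _ _, C, K, hCpos, hC1, fun p hp => ?_⟩
  have hp' := closedBall_subset_closedBall (min_le_left r r₁) hp
  refine ⟨(hrs hp').1.1, fun hz => ?_⟩
  have hz' : fderiv ℝ Φ p₀ = 0 := by simpa using hz
  have hsub : closedBall p₀ ‖p - p₀‖ ⊆ closedBall p₀ r :=
    closedBall_subset_closedBall (by simpa [dist_eq_norm] using hp')
  have h1 := (convex_closedBall p₀ ‖p - p₀‖).norm_image_sub_le_of_norm_fderiv_le (𝕜 := ℝ)
    (f := Φ) (C := K * ‖p - p₀‖) (x := p₀) (y := p)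
    (fun x hx => (hrs (hsub hx)).1.2.differentiableAt (by norm_num))
    (fun x hx => by
      have := hK.norm_sub_le (hrs (hsub hx)).2 (mem_of_mem_nhds ht)
      rw [hz', sub_zero] at this
      refine this.trans (mul_le_mul_of_nonneg_left ?_ K.2)
      simpa [dist_eq_norm] using hx)
    (mem_closedBall_self (norm_nonneg _)) (by simp [dist_eq_norm])
  rw [h0] at h1
  linarith [h1, sq ‖p - p₀‖, mul_assoc (K : ℝ) ‖p - p₀‖ ‖p - p₀‖]

noncomputable section

namespace SBDP

variable {V : Type*} [Fintype V] [DecidableEq V] {G : SimpleGraph V} [DecidableRel G.Adj]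
  {n ng nh : V → ℕ}

/-! ### Smoothness of the problem data and of the KKT map -/

theorem contDiff_primal_apply {m : WithTop ℕ∞} (i : V) :
    ContDiff ℝ m (fun p : PDVec n ng nh => primal p i) :=
  contDiff_euclidean.2 fun k => by simp only [primal]; fun_prop

theorem contDiff_primal {m : WithTop ℕ∞} :
    ContDiff ℝ m (fun p : PDVec n ng nh => primal p) :=
  contDiff_pi.2 contDiff_primal_apply

theorem contDiff_eqMult {m : WithTop ℕ∞} (i : V) :
    ContDiff ℝ m (fun p : PDVec n ng nh => eqMult p i) :=
  contDiff_euclidean.2 fun k => by simp only [eqMult]; fun_prop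

theorem contDiff_ineqMult {m : WithTop ℕ∞} (i : V) :
    ContDiff ℝ m (fun p : PDVec n ng nh => ineqMult p i) :=
  contDiff_euclidean.2 fun k => by simp only [ineqMult]; fun_prop

section

variable {Z : Type*} [NormedAddCommGroup Z] [NormedSpace ℝ Z] {m : WithTop ℕ∞}

theorem contDiff_function_update {x : Z → ∀ i, Vec (n i)} {i : V} {y : Z → Vec (n i)}
    (hx : ContDiff ℝ m x) (hy : ContDiff ℝ m y) :
    ContDiff ℝ m fun z => Function.update (x z) i (y z) := by
  refine contDiff_pi.2 fun j => ?_
  rcases eq_or_ne j i with rfl | hj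
  · simpa using hy
  · simpa [hj] using contDiff_pi.1 hx j

theorem inner_partialGradient (φ : (∀ i, Vec (n i)) → ℝ) (x : ∀ i, Vec (n i)) (i : V)
    (v : Vec (n i)) : inner ℝ (partialGradient φ x i) v =
      fderiv ℝ (fun y => φ (Function.update x i y)) (x i) v := by
  simp [partialGradient, gradient]

/-- The gradient costs one order: `C³` data give a `C²` KKT map, and so a `C²` map `Φ`, as the
quadratic estimate requires. -/
theorem contDiff_partialGradient {φ : Z → (∀ i, Vec (n i)) → ℝ}
    (hφ : ContDiff ℝ 3 (Function.uncurry φ)) {x : Z → ∀ i, Vec (n i)} (hx : ContDiff ℝ 3 x)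
    (i : V) : ContDiff ℝ 2 fun z => partialGradient (φ z) (x z) i := by
  have h : ContDiff ℝ 2 fun z => fderiv ℝ (fun y => φ z (Function.update (x z) i y)) (x z i) := by
    refine ContDiff.fderiv (m := 3) (f := fun z y => φ z (Function.update (x z) i y)) ?_
      ((contDiff_pi.1 hx i).of_le (by norm_num)) (by norm_num)
    exact hφ.comp (contDiff_fst.prodMk (contDiff_function_update (hx.comp contDiff_fst)
      contDiff_snd))
  exact (InnerProductSpace.toDual ℝ (Vec (n i))).symm.toContinuousLinearEquiv.contDiff.comp h

theorem contDiff_eval_prod_neighbors (i : V) :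
    ContDiff ℝ m fun x : ∀ i, Vec (n i) => (x i, fun j : G.neighborSet i => x j) :=
  (contDiff_pi.1 contDiff_id i).prodMk (contDiff_pi.2 fun j => contDiff_pi.1 contDiff_id j.1)

namespace NLP

variable {P : NLP G n ng nh}

theorem IsSmooth.fAt (hP : P.IsSmooth) (i : V) : ContDiff ℝ 3 (P.fAt i) :=
  (hP.f i).comp (contDiff_eval_prod_neighbors i)

theorem IsSmooth.gAt (hP : P.IsSmooth) (i : V) : ContDiff ℝ 3 (P.gAt i) :=
  (hP.g i).comp (contDiff_eval_prod_neighbors i)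

theorem IsSmooth.hAt (hP : P.IsSmooth) (i : V) : ContDiff ℝ 3 (P.hAt i) :=
  (hP.h i).comp (contDiff_eval_prod_neighbors i)

theorem IsSmooth.localLagrangian (hP : P.IsSmooth) (i : V) {x : Z → ∀ i, Vec (n i)}
    {lam : Z → Vec (ng i)} {mu : Z → Vec (nh i)} (hm : m ≤ 3) (hx : ContDiff ℝ m x)
    (hlam : ContDiff ℝ m lam) (hmu : ContDiff ℝ m mu) :
    ContDiff ℝ m fun z => P.localLagrangian i (x z) (lam z) (mu z) :=
  ((((hP.fAt i).of_le hm).comp hx).add (hlam.inner ℝ (((hP.gAt i).of_le hm).comp hx))).add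
    (hmu.inner ℝ (((hP.hAt i).of_le hm).comp hx))

theorem contDiff_mixed {p : Z → PDVec n ng nh} {i : V} {y : Z → Vec (n i)}
    (hp : ContDiff ℝ m p) (hy : ContDiff ℝ m y) : ContDiff ℝ m fun z => mixed (p z) i (y z) :=
  contDiff_function_update (contDiff_primal.comp hp) hy

theorem IsSmooth.sensitivity (hP : P.IsSmooth) (i j : V) :
    ContDiff ℝ 2 fun p => P.sensitivity p i j :=
  contDiff_partialGradient (φ := fun p x => P.localLagrangian j x (eqMult p j) (ineqMult p j))
    (hP.localLagrangian j le_rfl contDiff_snd ((contDiff_eqMult j).comp contDiff_fst)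
      ((contDiff_ineqMult j).comp contDiff_fst)) contDiff_primal i

theorem IsSmooth.kktMap (hP : P.IsSmooth) :
    ContDiff ℝ 2 (Function.uncurry P.kktMap) := by
  have hmix : ∀ i {m : WithTop ℕ∞}, ContDiff ℝ m fun z : PDVec n ng nh × PDVec n ng nh =>
      mixed z.2 i (primal z.1 i) := fun i =>
    contDiff_mixed contDiff_snd ((contDiff_primal_apply i).comp contDiff_fst)
  refine contDiff_euclidean.2 ?_
  rintro ⟨i, k | k | k⟩
  · have hs : ContDiff ℝ 2 fun z : PDVec n ng nh × PDVec n ng nh =>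
        ∑ j : G.neighborSet i, P.sensitivity z.2 i j :=
      ContDiff.sum fun j _ => (hP.sensitivity i j).comp contDiff_snd
    refine contDiff_euclidean.1 (ContDiff.add ?_ hs) k
    exact contDiff_partialGradient (φ := fun (z : PDVec n ng nh × PDVec n ng nh) x =>
        P.localLagrangian i x (eqMult z.1 i) (ineqMult z.1 i))
      (hP.localLagrangian i le_rfl contDiff_snd
        ((contDiff_eqMult i).comp (contDiff_fst.comp contDiff_fst))
        ((contDiff_ineqMult i).comp (contDiff_fst.comp contDiff_fst))) (hmix i) i
  · exact contDiff_euclidean.1 (((hP.gAt i).of_le (by norm_num)).comp (hmix i)) k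
  · have hmu : ContDiff ℝ 2 fun z : PDVec n ng nh × PDVec n ng nh => ineqMult z.1 i :=
      (contDiff_ineqMult i).comp contDiff_fst
    exact (contDiff_euclidean.1 hmu k).mul
      (contDiff_euclidean.1 (((hP.hAt i).of_le (by norm_num)).comp (hmix i)) k)

/-- The Lagrangian is affine in the multipliers. -/
theorem fderiv_localLagrangian_update (hP : P.IsSmooth) (x : ∀ i, Vec (n i)) (i : V)
    (lam lam' : Vec (ng i)) (mu mu' : Vec (nh i)) (y v : Vec (n i)) :
    fderiv ℝ (fun y => P.localLagrangian i (Function.update x i y) lam' mu') y v =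
      fderiv ℝ (fun y => P.localLagrangian i (Function.update x i y) lam mu) y v +
        ∑ k, (lam' k - lam k) * fderiv ℝ (fun y => P.gAt i (Function.update x i y) k) y v +
        ∑ k, (mu' k - mu k) * fderiv ℝ (fun y => P.hAt i (Function.update x i y) k) y v := by
  have hup : ContDiff ℝ 3 fun y : Vec (n i) => Function.update x i y :=
    contDiff_function_update contDiff_const contDiff_id
  have hL := ((hP.localLagrangian i le_rfl hup (contDiff_const (c := lam))
    (contDiff_const (c := mu))).differentiable (by norm_num) y).hasFDerivAt
  have hg := fun k => ((contDiff_euclidean.1 ((hP.gAt i).comp hup) k).differentiable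
    (by norm_num) y).hasFDerivAt
  have hh := fun k => ((contDiff_euclidean.1 ((hP.hAt i).comp hup) k).differentiable
    (by norm_num) y).hasFDerivAt
  have key := (hL.add (HasFDerivAt.fun_sum (u := Finset.univ) fun k _ =>
    (hg k).const_mul (lam' k - lam k))).add
    (HasFDerivAt.fun_sum (u := Finset.univ) fun k _ => (hh k).const_mul (mu' k - mu k))
  have heq : (fun y => P.localLagrangian i (Function.update x i y) lam' mu') = fun y =>
      P.localLagrangian i (Function.update x i y) lam mu +
        ∑ k, (lam' k - lam k) * P.gAt i (Function.update x i y) k +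
        ∑ k, (mu' k - mu k) * P.hAt i (Function.update x i y) k := by
    funext y
    simp only [NLP.localLagrangian, PiLp.inner_apply, sub_mul, Finset.sum_sub_distrib,
      RCLike.inner_apply, conj_trivial, mul_comm]
    ring
  rw [heq]
  refine (congrArg (fun T => T v) (HasFDerivAt.fderiv key)).trans ?_
  simp

end NLP

end

namespace NLP

variable {P : NLP G n ng nh}

/-! ### Blocks of the matrix `M` and its invertibility -/

theorem primal_line (q d : PDVec n ng nh) (t : ℝ) (i : V) :
    primal (q + t • d) i = primal q i + t • primal d i := rfl

theorem eqMult_line (q d : PDVec n ng nh) (t : ℝ) (i : V) :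
    eqMult (q + t • d) i = eqMult q i + t • eqMult d i := rfl

theorem ineqMult_line (q d : PDVec n ng nh) (t : ℝ) (i : V) :
    ineqMult (q + t • d) i = ineqMult q i + t • ineqMult d i := rfl

/-- The primal block of the stacked local KKT equations, tested against a direction. -/
theorem inner_primal_kktMap (q p : PDVec n ng nh) (i : V) (v : Vec (n i)) :
    inner ℝ (primal (P.kktMap q p) i) v =
      fderiv ℝ (fun y => P.localLagrangian i (Function.update (primal p) i y) (eqMult q i)
        (ineqMult q i)) (primal q i) v + inner ℝ (∑ j : G.neighborSet i, P.sensitivity p i j) v := by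
  have h : primal (P.kktMap q p) i = partialGradient (fun x => P.localLagrangian i x (eqMult q i)
      (ineqMult q i)) (mixed p i (primal q i)) i + ∑ j : G.neighborSet i, P.sensitivity p i j :=
    rfl
  rw [h, inner_add_left, inner_partialGradient]
  simp [mixed]

theorem eqMult_kktMap (q p : PDVec n ng nh) (i : V) :
    eqMult (P.kktMap q p) i = P.gAt i (mixed p i (primal q i)) := rfl

theorem ineqMult_kktMap (q p : PDVec n ng nh) (i : V) (k : Fin (nh i)) :
    ineqMult (P.kktMap q p) i k = ineqMult q i k * P.hAt i (mixed p i (primal q i)) k := rfl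

theorem hasDerivAt_kktMap_line (hP : P.IsSmooth) (q p d : PDVec n ng nh) :
    HasDerivAt (fun t : ℝ => P.kktMap (q + t • d) p) (P.matM q p d) 0 := by
  have h1 : DifferentiableAt ℝ (fun q' => P.kktMap q' p) (q + (0 : ℝ) • d) :=
    (hP.kktMap.comp (contDiff_id.prodMk contDiff_const)).differentiable (by norm_num) _
  have h2 : HasDerivAt (fun t : ℝ => q + t • d) d 0 := by
    simpa using ((hasDerivAt_id (0 : ℝ)).smul_const d).const_add q
  have := h1.hasFDerivAt.comp_hasDerivAt (0 : ℝ) h2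
  rw [zero_smul, add_zero] at this
  exact this

theorem _root_.HasDerivAt.euclidean_apply {ι : Type*} [Fintype ι] {φ : ℝ → EuclideanSpace ℝ ι}
    {φ' : EuclideanSpace ℝ ι} {t : ℝ} (h : HasDerivAt φ φ' t) (k : ι) :
    HasDerivAt (fun t => φ t k) (φ' k) t :=
  (EuclideanSpace.proj (𝕜 := ℝ) k).hasFDerivAt.comp_hasDerivAt t h

theorem _root_.fderiv_euclidean_apply {ι E : Type*} [Fintype ι] [NormedAddCommGroup E]
    [NormedSpace ℝ E] {φ : E → EuclideanSpace ℝ ι} {x : E} (h : DifferentiableAt ℝ φ x) (k : ι)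
    (s : E) : fderiv ℝ (fun y => φ y k) x s = fderiv ℝ φ x s k := by
  have := ((EuclideanSpace.proj (𝕜 := ℝ) k).hasFDerivAt.comp x h.hasFDerivAt).fderiv
  exact congrArg (fun T => T s) this

theorem _root_.HasDerivAt.comp_line {E F : Type*} [NormedAddCommGroup E] [NormedSpace ℝ E]
    [NormedAddCommGroup F] [NormedSpace ℝ F] {φ : E → F} {x : E}
    (h : DifferentiableAt ℝ φ x) (s : E) :
    HasDerivAt (fun t : ℝ => φ (x + t • s)) (fderiv ℝ φ x s) 0 := by
  have h2 : HasDerivAt (fun t : ℝ => x + t • s) s 0 := by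
    simpa using ((hasDerivAt_id (0 : ℝ)).smul_const s).const_add x
  have h1 : HasFDerivAt φ (fderiv ℝ φ x) (x + (0 : ℝ) • s) := by simpa using h.hasFDerivAt
  exact h1.comp_hasDerivAt (0 : ℝ) h2

theorem contDiff_localLagrangian_update (hP : P.IsSmooth) (x : ∀ i, Vec (n i)) (i : V)
    (lam : Vec (ng i)) (mu : Vec (nh i)) :
    ContDiff ℝ 3 fun y => P.localLagrangian i (Function.update x i y) lam mu :=
  hP.localLagrangian i le_rfl (contDiff_function_update contDiff_const contDiff_id)
    contDiff_const contDiff_const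

theorem contDiff_gAt_update (hP : P.IsSmooth) (x : ∀ i, Vec (n i)) (i : V) :
    ContDiff ℝ 3 fun y => P.gAt i (Function.update x i y) :=
  (hP.gAt i).comp (contDiff_function_update contDiff_const contDiff_id)

theorem contDiff_hAt_update (hP : P.IsSmooth) (x : ∀ i, Vec (n i)) (i : V) :
    ContDiff ℝ 3 fun y => P.hAt i (Function.update x i y) :=
  (hP.hAt i).comp (contDiff_function_update contDiff_const contDiff_id)

theorem primal_matM (hP : P.IsSmooth) (q p d : PDVec n ng nh) (i : V) (v : Vec (n i)) :
    inner ℝ (primal (P.matM q p d) i) v =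
      fderiv ℝ (fderiv ℝ fun y => P.localLagrangian i (Function.update (primal p) i y)
        (eqMult q i) (ineqMult q i)) (primal q i) (primal d i) v +
      ∑ k, eqMult d i k *
        fderiv ℝ (fun y => P.gAt i (Function.update (primal p) i y) k) (primal q i) v +
      ∑ k, ineqMult d i k *
        fderiv ℝ (fun y => P.hAt i (Function.update (primal p) i y) k) (primal q i) v := by
  have h1 : HasDerivAt (fun t : ℝ => inner ℝ (primal (P.kktMap (q + t • d) p) i) v)
      (inner ℝ (primal (P.matM q p d) i) v) 0 := by
    have hc := HasDerivAt.fun_sum (u := Finset.univ) fun k _ =>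
      ((hasDerivAt_kktMap_line hP q p d).euclidean_apply ⟨i, Sum.inl k⟩).inner ℝ
        (hasDerivAt_const (0 : ℝ) (v k))
    simp only [inner_zero_right, zero_add] at hc
    simp only [PiLp.inner_apply]
    exact hc
  have hL := contDiff_localLagrangian_update hP (primal p) i (eqMult q i) (ineqMult q i)
  have hg := contDiff_euclidean.1 (contDiff_gAt_update hP (primal p) i)
  have hh := contDiff_euclidean.1 (contDiff_hAt_update hP (primal p) i)
  have e1 := (HasDerivAt.comp_line ((hL.fderiv_right (m := 2) (by norm_num)).differentiable
    (by norm_num) (primal q i)) (primal d i)).clm_apply (hasDerivAt_const (0 : ℝ) v)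
  -- The multiplier increment `t * a` vanishes at `t = 0`, so the product rule keeps no second
  -- derivative of `u`.
  have e2 : ∀ (u : Vec (n i) → ℝ) (a : ℝ), ContDiff ℝ 3 u → HasDerivAt
      (fun t : ℝ => t * a * fderiv ℝ u (primal q i + t • primal d i) v)
      (a * fderiv ℝ u (primal q i) v) 0 := by
    intro u a hu
    have e3 := (HasDerivAt.comp_line ((hu.fderiv_right (m := 2) (by norm_num)).differentiable
      (by norm_num) (primal q i)) (primal d i)).clm_apply (hasDerivAt_const (0 : ℝ) v)
    have e4 := ((hasDerivAt_id (0 : ℝ)).mul_const a).mul e3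
    simp only [id_eq, zero_mul, one_mul, zero_smul, add_zero] at e4
    exact e4
  have h2 := (e1.add (HasDerivAt.fun_sum (u := Finset.univ) fun k _ =>
    e2 _ (eqMult d i k) (hg k))).add (HasDerivAt.fun_sum (u := Finset.univ) fun k _ =>
    e2 _ (ineqMult d i k) (hh k))
  have h3 := h2.add_const (inner ℝ (∑ j : G.neighborSet i, P.sensitivity p i j) v)
  refine (h1.unique (h3.congr_of_eventuallyEq (Eventually.of_forall fun t => ?_))).trans ?_
  · simp only [inner_primal_kktMap]
    rw [fderiv_localLagrangian_update hP (primal p) i (eqMult q i) _ (ineqMult q i)]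
    simp [primal_line, eqMult_line, ineqMult_line]
  · simp

theorem eqMult_matM (hP : P.IsSmooth) (q p d : PDVec n ng nh) (i : V) (k : Fin (ng i)) :
    eqMult (P.matM q p d) i k =
      fderiv ℝ (fun y => P.gAt i (Function.update (primal p) i y) k) (primal q i) (primal d i) := by
  have h1 := (hasDerivAt_kktMap_line hP q p d).euclidean_apply ⟨i, Sum.inr (Sum.inl k)⟩
  have hg := contDiff_euclidean.1 (contDiff_gAt_update hP (primal p) i) k
  exact h1.unique (HasDerivAt.comp_line (hg.differentiable (by norm_num) (primal q i)) (primal d i))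

theorem ineqMult_matM (hP : P.IsSmooth) (q p d : PDVec n ng nh) (i : V) (k : Fin (nh i)) :
    ineqMult (P.matM q p d) i k =
      ineqMult d i k * P.hAt i (Function.update (primal p) i (primal q i)) k +
      ineqMult q i k * fderiv ℝ (fun y => P.hAt i (Function.update (primal p) i y) k) (primal q i)
        (primal d i) := by
  have h1 := (hasDerivAt_kktMap_line hP q p d).euclidean_apply ⟨i, Sum.inr (Sum.inr k)⟩
  have hh := contDiff_euclidean.1 (contDiff_hAt_update hP (primal p) i) k
  have e1 : HasDerivAt (fun t : ℝ => ineqMult q i k + t * ineqMult d i k) (ineqMult d i k) 0 := by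
    simpa using ((hasDerivAt_id (0 : ℝ)).mul_const (ineqMult d i k)).const_add (ineqMult q i k)
  have e2 := e1.mul
    (HasDerivAt.comp_line (hh.differentiable (by norm_num) (primal q i)) (primal d i))
  simp only [zero_smul, add_zero, zero_mul] at e2
  exact h1.unique e2

/-- Complementarity rows put the primal part of a kernel vector in the critical subspace and kill
its inactive multipliers. Testing stationarity with the primal part itself contradicts the
second-order condition unless it is zero; what remains is a linear relation between active
gradients, excluded by LICQ. -/
theorem matM_injective (hP : P.IsSmooth) {p : PDVec n ng nh} (hKKT : P.IsCentralKKT p)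
    (hcompl : ∀ i k, P.hAt i (primal p) k = 0 → 0 < ineqMult p i k)
    (hlocal : P.LocalRegularity p) {d : PDVec n ng nh} (hd : P.matM p p d = 0) : d = 0 := by
  have hblock : ∀ i, primal d i = 0 ∧ eqMult d i = 0 ∧ ineqMult d i = 0 := by
    intro i
    have hstat : ∀ v, _ = _ := fun v => primal_matM hP p p d i v
    have hz : primal (P.matM p p d) i = 0 := by rw [hd]; rfl
    have heq : ∀ k, fderiv ℝ (fun y => P.gAt i (Function.update (primal p) i y) k) (primal p i)
        (primal d i) = 0 := fun k => by rw [← eqMult_matM hP, hd]; rfl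
    have hineq : ∀ k, ineqMult d i k * P.hAt i (primal p) k + ineqMult p i k *
        fderiv ℝ (fun y => P.hAt i (Function.update (primal p) i y) k) (primal p i)
          (primal d i) = 0 := fun k => by
      have := ineqMult_matM hP p p d i k
      rw [Function.update_eq_self, hd] at this
      exact this.symm
    have hact : ∀ k, P.hAt i (primal p) k = 0 →
        fderiv ℝ (fun y => P.hAt i (Function.update (primal p) i y) k) (primal p i)
          (primal d i) = 0 := fun k hk => by
      have := hineq k
      rw [hk, mul_zero, zero_add] at this
      exact (mul_eq_zero.1 this).resolve_left (hcompl i k hk).ne'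
    have hinact : ∀ k, P.hAt i (primal p) k ≠ 0 → ineqMult d i k = 0 := fun k hk => by
      have h1 := hineq k
      have h2 := (mul_eq_zero.1 (hKKT.compl i k)).resolve_right hk
      rw [h2, zero_mul, add_zero] at h1
      exact (mul_eq_zero.1 h1).resolve_right hk
    simp only [hz, inner_zero_left] at hstat
    have hs : primal d i = 0 := by
      by_contra hne
      have hpos := hlocal.sosc i (primal d i) hne (by
        ext k
        have hg := (contDiff_gAt_update hP (primal p) i).differentiable (by norm_num) (primal p i)
        rw [← fderiv_euclidean_apply hg]
        exact heq k) hact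
      have h1 := hstat (primal d i)
      simp only [heq, mul_zero, Finset.sum_const_zero, add_zero] at h1
      rw [Finset.sum_eq_zero (fun k _ => ?_), add_zero] at h1
      · exact hpos.ne h1
      · by_cases hk : P.hAt i (primal p) k = 0
        · rw [hact k hk, mul_zero]
        · rw [hinact k hk, zero_mul]
    have hli := Fintype.linearIndependent_iff.1 (hlocal.licq i)
      (Sum.elim (fun k => eqMult d i k) fun k => ineqMult d i k) (by
        ext v
        have h1 := hstat v
        rw [hs, map_zero] at h1
        simp only [Fintype.sum_sum_type, Sum.elim_inl, Sum.elim_inr]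
        have h2 : ∑ k : {k : Fin (nh i) // P.hAt i (primal p) k = 0}, ineqMult d i k *
            fderiv ℝ (fun y => P.hAt i (Function.update (primal p) i y) k) (primal p i) v =
            ∑ k, ineqMult d i k *
              fderiv ℝ (fun y => P.hAt i (Function.update (primal p) i y) k) (primal p i) v := by
          rw [← Fintype.sum_subtype_add_sum_subtype (fun k => P.hAt i (primal p) k = 0), eq_comm,
            add_eq_left]
          exact Finset.sum_eq_zero fun k _ => by rw [hinact k.1 k.2, zero_mul]
        simp [h2]
        simpa using h1.symm)
    refine ⟨hs, ?_, ?_⟩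
    · ext k
      exact hli (Sum.inl k)
    · ext k
      by_cases hk : P.hAt i (primal p) k = 0
      · exact hli (Sum.inr ⟨k, hk⟩)
      · exact hinact k hk
  ext ⟨i, k | k | k⟩
  · exact congrArg (fun v => v k) (hblock i).1
  · exact congrArg (fun v => v k) (hblock i).2.1
  · exact congrArg (fun v => v k) (hblock i).2.2

theorem matM_isInvertible (hP : P.IsSmooth) {p : PDVec n ng nh} (hKKT : P.IsCentralKKT p)
    (hcompl : ∀ i k, P.hAt i (primal p) k = 0 → 0 < ineqMult p i k)
    (hlocal : P.LocalRegularity p) : (P.matM p p).IsInvertible := by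
  have hinj : Function.Injective (P.matM p p).toLinearMap :=
    (injective_iff_map_eq_zero _).2 fun d hd => matM_injective hP hKKT hcompl hlocal hd
  exact ⟨(LinearEquiv.ofInjectiveEndo _ hinj).toContinuousLinearEquiv, by ext; rfl⟩

/-! ### From the central KKT conditions to solutions of the local programs -/

theorem kktMap_eq_zero {p q : PDVec n ng nh}
    (h : ∀ i, P.IsLocalKKT p i (fun j => P.sensitivity p i j) (primal q i) (eqMult q i)
      (ineqMult q i)) : P.kktMap q p = 0 := by
  ext ⟨i, k | k | k⟩
  · exact congrArg (fun v => v k) (h i).stationary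
  · exact congrArg (fun v => v k) (h i).eq_feasible
  · exact (h i).compl k

theorem fAt_update_of_not_adj {i j : V} (hij : j ≠ i) (hadj : ¬ G.Adj i j) (x : ∀ i, Vec (n i))
    (y : Vec (n i)) : P.fAt j (Function.update x i y) = P.fAt j x := by
  simp only [fAt, Function.update_of_ne hij]
  congr 1
  funext l
  have hl : (l : V) ≠ i := by
    rintro rfl
    exact hadj (G.adj_symm l.2)
  exact Function.update_of_ne hl _ _

theorem gAt_update_of_not_adj {i j : V} (hij : j ≠ i) (hadj : ¬ G.Adj i j) (x : ∀ i, Vec (n i))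
    (y : Vec (n i)) : P.gAt j (Function.update x i y) = P.gAt j x := by
  simp only [gAt, Function.update_of_ne hij]
  congr 1
  funext l
  have hl : (l : V) ≠ i := by
    rintro rfl
    exact hadj (G.adj_symm l.2)
  exact Function.update_of_ne hl _ _

theorem hAt_update_of_not_adj {i j : V} (hij : j ≠ i) (hadj : ¬ G.Adj i j) (x : ∀ i, Vec (n i))
    (y : Vec (n i)) : P.hAt j (Function.update x i y) = P.hAt j x := by
  simp only [hAt, Function.update_of_ne hij]
  congr 1
  funext l
  have hl : (l : V) ≠ i := by
    rintro rfl
    exact hadj (G.adj_symm l.2)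
  exact Function.update_of_ne hl _ _

theorem sensitivity_eq_zero_of_not_adj (p : PDVec n ng nh) {i j : V} (hij : j ≠ i)
    (hadj : ¬ G.Adj i j) : P.sensitivity p i j = 0 := by
  simp [sensitivity, partialGradient, localLagrangian, fAt_update_of_not_adj hij hadj,
    gAt_update_of_not_adj hij hadj, hAt_update_of_not_adj hij hadj, gradient]

theorem _root_.SimpleGraph.sum_eq_add_sum_neighborSet {M : Type*} [AddCommMonoid M] (i : V)
    (a : V → M) (ha : ∀ j, j ≠ i → ¬ G.Adj i j → a j = 0) :
    ∑ j, a j = a i + ∑ j : G.neighborSet i, a j := by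
  rw [← Fintype.sum_subtype_add_sum_subtype (fun j => G.Adj i j), add_comm]
  congr 1
  exact Finset.sum_eq_single (⟨i, G.irrefl⟩ : {j // ¬ G.Adj i j})
    (fun j _ hj => ha j (fun h => hj (Subtype.ext h)) j.2) (by simp)

theorem partialGradient_lagrangian (hP : P.IsSmooth) (p : PDVec n ng nh) (i : V) :
    partialGradient (fun x => P.lagrangian x (eqMult p) (ineqMult p)) (primal p) i =
      P.sensitivity p i i + ∑ j : G.neighborSet i, P.sensitivity p i j := by
  rw [← SimpleGraph.sum_eq_add_sum_neighborSet i (fun j => P.sensitivity p i j)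
    fun j => sensitivity_eq_zero_of_not_adj p]
  refine ext_inner_right ℝ fun v => ?_
  rw [inner_partialGradient, sum_inner]
  simp only [sensitivity, inner_partialGradient, lagrangian]
  have hd : ∀ j, DifferentiableAt ℝ (fun y => P.localLagrangian j
      (Function.update (primal p) i y) (eqMult p j) (ineqMult p j)) (primal p i) := fun j =>
    (hP.localLagrangian j le_rfl (contDiff_function_update contDiff_const contDiff_id)
      contDiff_const contDiff_const).differentiable (by norm_num) _
  rw [fderiv_fun_sum fun j _ => hd j]
  simp

theorem kktMap_self (hP : P.IsSmooth) {p : PDVec n ng nh} (hKKT : P.IsCentralKKT p) :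
    P.kktMap p p = 0 := by
  have hmix : ∀ i, mixed p i (primal p i) = primal p := fun i => Function.update_eq_self i _
  refine kktMap_eq_zero fun i => ⟨?_, ?_, ?_, ?_, hKKT.mult_nonneg i⟩
  · rw [hmix]
    exact (partialGradient_lagrangian hP p i).symm.trans (hKKT.stationary i)
  · rw [hmix]; exact hKKT.eq_feasible i
  · rw [hmix]; exact hKKT.compl i
  · rw [hmix]; exact hKKT.ineq_feasible i

/-- The Lagrangian of the local program of agent `i`, including the sensitivity terms. -/
def localProgramLagrangian (P : NLP G n ng nh) (i : V) (z : PDVec n ng nh × PDVec n ng nh)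
    (y : Vec (n i)) : ℝ :=
  P.localLagrangian i (mixed z.2 i y) (eqMult z.1 i) (ineqMult z.1 i) +
    ∑ j : G.neighborSet i, inner ℝ (P.sensitivity z.2 i j) (y - primal z.2 i)

theorem IsSmooth.localProgramLagrangian (hP : P.IsSmooth) (i : V) :
    ContDiff ℝ 2 (Function.uncurry (P.localProgramLagrangian i)) := by
  have h1 : ∀ {m : WithTop ℕ∞}, ContDiff ℝ m
      fun z : (PDVec n ng nh × PDVec n ng nh) × Vec (n i) => z.1.2 :=
    contDiff_snd.comp contDiff_fst
  have h2 : ∀ {m : WithTop ℕ∞}, ContDiff ℝ m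
      fun z : (PDVec n ng nh × PDVec n ng nh) × Vec (n i) => z.1.1 :=
    contDiff_fst.comp contDiff_fst
  refine (hP.localLagrangian i (by norm_num) (contDiff_mixed h1 contDiff_snd)
    ((contDiff_eqMult i).comp h2) ((contDiff_ineqMult i).comp h2)).add
    (ContDiff.sum fun j _ => ?_)
  exact ((hP.sensitivity i j).comp h1).inner ℝ
    (contDiff_snd.sub ((contDiff_primal_apply i).comp h1))

theorem hasFDerivAt_localProgramLagrangian (hP : P.IsSmooth) (i : V)
    (z : PDVec n ng nh × PDVec n ng nh) (y : Vec (n i)) :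
    HasFDerivAt (P.localProgramLagrangian i z)
      (fderiv ℝ (fun y => P.localLagrangian i (Function.update (primal z.2) i y) (eqMult z.1 i)
        (ineqMult z.1 i)) y + ∑ j : G.neighborSet i, innerSL ℝ (P.sensitivity z.2 i j)) y := by
  refine (((contDiff_localLagrangian_update hP (primal z.2) i (eqMult z.1 i)
    (ineqMult z.1 i)).differentiable (by norm_num) y).hasFDerivAt).add
    (HasFDerivAt.fun_sum fun j _ => ?_)
  exact (innerSL ℝ (P.sensitivity z.2 i j)).hasFDerivAt.comp y
    ((hasFDerivAt_id y).sub_const (primal z.2 i))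

/-- Near a regular KKT point, the zeros of the stacked local KKT equations solve the local
programs. -/
theorem eventually_solvesLocal (hP : P.IsSmooth) {p₀ : PDVec n ng nh}
    (hKKT : P.IsCentralKKT p₀)
    (hcompl : ∀ i k, P.hAt i (primal p₀) k = 0 → 0 < ineqMult p₀ i k)
    (hlocal : P.LocalRegularity p₀) :
    ∀ᶠ z in 𝓝 (p₀, p₀), P.kktMap z.1 z.2 = 0 →
      P.SolvesLocal z.2 (fun i j => P.sensitivity z.2 i j) z.1 := by
  simp only [SolvesLocal, forall_comm (β := V)]
  rw [eventually_all]
  intro i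
  have hmix : mixed p₀ i (primal p₀ i) = primal p₀ := Function.update_eq_self i _
  have hyc : Continuous fun z : PDVec n ng nh × PDVec n ng nh => primal z.1 i :=
    (contDiff_primal_apply (m := 0) i).continuous.comp continuous_fst
  have hmuc : ∀ k, Continuous fun z : PDVec n ng nh × PDVec n ng nh => ineqMult z.1 i k :=
    fun k => ((contDiff_euclidean.1 (contDiff_ineqMult (m := 0) i) k).continuous).comp
      continuous_fst
  have hhc : ∀ k, Continuous fun z : PDVec n ng nh × PDVec n ng nh =>
      P.hAt i (mixed z.2 i (primal z.1 i)) k := fun k =>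
    ((contDiff_euclidean.1 (hP.hAt i) k).continuous).comp (contDiff_mixed (m := 0) contDiff_snd
      ((contDiff_primal_apply i).comp contDiff_fst)).continuous
  -- Strict complementarity is an open condition: the active set cannot change for zeros of the KKT
  -- map near the base point.
  have hsign : ∀ᶠ z in 𝓝 (p₀, p₀), ∀ k, (P.hAt i (primal p₀) k = 0 → 0 < ineqMult z.1 i k) ∧
      (P.hAt i (primal p₀) k ≠ 0 → P.hAt i (mixed z.2 i (primal z.1 i)) k < 0) := by
    rw [eventually_all]
    intro k
    by_cases hk : P.hAt i (primal p₀) k = 0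
    · filter_upwards [(hmuc k).continuousAt.eventually_const_lt (hcompl i k hk)] with z hz
      exact ⟨fun _ => hz, fun h => absurd hk h⟩
    · have : P.hAt i (mixed p₀ i (primal p₀ i)) k < 0 := by
        rw [hmix]; exact lt_of_le_of_ne (hKKT.ineq_feasible i k) hk
      filter_upwards [(hhc k).continuousAt.eventually_lt_const this] with z hz
      exact ⟨fun h => absurd h hk, fun _ => hz⟩
  -- Constraints active at `p₀` join the equalities in the penalty, with `z` as parameter.
  set u : Fin (ng i) ⊕ {k : Fin (nh i) // P.hAt i (primal p₀) k = 0} →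
      PDVec n ng nh × PDVec n ng nh → Vec (n i) → ℝ :=
    Sum.elim (fun k z y => P.gAt i (mixed z.2 i y) k) (fun k z y => P.hAt i (mixed z.2 i y) k)
    with hu
  have hmixc : ContDiff ℝ 2 fun z : (PDVec n ng nh × PDVec n ng nh) × Vec (n i) =>
      mixed z.1.2 i z.2 := contDiff_mixed (contDiff_snd.comp contDiff_fst) contDiff_snd
  have huc : ∀ a, ContDiff ℝ 2 (Function.uncurry (u a)) := by
    rintro (k | k)
    · exact contDiff_euclidean.1 (((hP.gAt i).of_le (by norm_num)).comp hmixc) k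
    · exact contDiff_euclidean.1 (((hP.hAt i).of_le (by norm_num)).comp hmixc) k
  obtain ⟨c, hc, δ, hδ, hmin⟩ := exists_augmented_min (hP.localProgramLagrangian i) huc (p₀, p₀)
    (primal p₀ i) (by
      rintro (k | k)
      · simp [hu, hmix, hKKT.eq_feasible i]
      · simp [hu, hmix, k.2]) (by
      intro s hs h0
      -- The sensitivity terms are affine in `y`, so they leave the Hessian of `L_i` unchanged.
      have hfd : fderiv ℝ (P.localProgramLagrangian i (p₀, p₀)) = fun y =>
          fderiv ℝ (fun y => P.localLagrangian i (Function.update (primal p₀) i y) (eqMult p₀ i)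
            (ineqMult p₀ i)) y + ∑ j : G.neighborSet i, innerSL ℝ (P.sensitivity p₀ i j) :=
        funext fun y => (hasFDerivAt_localProgramLagrangian hP i (p₀, p₀) y).fderiv
      rw [hfd, fderiv_add_const]
      refine hlocal.sosc i s hs ?_ fun k hk => h0 (Sum.inr ⟨k, hk⟩)
      ext k
      rw [← fderiv_euclidean_apply ((contDiff_gAt_update hP (primal p₀) i).differentiable
        (by norm_num) _)]
      exact h0 (Sum.inl k))
  filter_upwards [hsign, ball_mem_nhds (p₀, p₀) hδ,
    hyc.continuousAt.preimage_mem_nhds (ball_mem_nhds (primal p₀ i) hδ)] with z hz hzδ hyδ hzero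
  have hstat : primal (P.kktMap z.1 z.2) i = 0 := by rw [hzero]; rfl
  have hg : P.gAt i (mixed z.2 i (primal z.1 i)) = 0 := by
    rw [← eqMult_kktMap, hzero]; rfl
  have hcs : ∀ k, ineqMult z.1 i k * P.hAt i (mixed z.2 i (primal z.1 i)) k = 0 := fun k => by
    rw [← ineqMult_kktMap, hzero]; rfl
  have hact : ∀ k, P.hAt i (primal p₀) k = 0 →
      P.hAt i (mixed z.2 i (primal z.1 i)) k = 0 := fun k hk =>
    (mul_eq_zero.1 (hcs k)).resolve_left ((hz k).1 hk).ne'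
  have hinact : ∀ k, P.hAt i (primal p₀) k ≠ 0 → ineqMult z.1 i k = 0 := fun k hk =>
    (mul_eq_zero.1 (hcs k)).resolve_right ((hz k).2 hk).ne
  refine ⟨?_, hstat, hg, hcs, fun k => ?_, fun k => ?_⟩
  · have hval : ∀ y, P.localProgramLagrangian i z y =
        P.localObjective z.2 i (fun j => P.sensitivity z.2 i j) y +
          ∑ k, eqMult z.1 i k * P.gAt i (mixed z.2 i y) k +
          ∑ k, ineqMult z.1 i k * P.hAt i (mixed z.2 i y) k := by
      intro y
      simp only [NLP.localProgramLagrangian, localLagrangian, localObjective, PiLp.inner_apply,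
        RCLike.inner_apply, conj_trivial, mul_comm]
      ring
    have hhy : ∀ k, Continuous fun y => P.hAt i (mixed z.2 i y) k := fun k =>
      contDiff_euclidean.1 (contDiff_hAt_update hP (primal z.2) i) k |>.continuous
    -- For feasible `y` the multiplier and penalty terms combine to `h * (mu + c * h)`. Keeping the
    -- second factor positive makes this nonpositive, so the augmented bound implies one for the
    -- objective.
    have hnear : ∀ᶠ y in 𝓝 (primal z.1 i), ∀ k, P.hAt i (primal p₀) k = 0 →
        0 < ineqMult z.1 i k + c * P.hAt i (mixed z.2 i y) k := by
      rw [eventually_all]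
      intro k
      by_cases hk : P.hAt i (primal p₀) k = 0
      · have hcont : Continuous fun y => ineqMult z.1 i k + c * P.hAt i (mixed z.2 i y) k :=
          continuous_const.add (continuous_const.mul (hhy k))
        have h0 : 0 < ineqMult z.1 i k + c * P.hAt i (mixed z.2 i (primal z.1 i)) k := by
          rw [hact k hk, mul_zero, add_zero]; exact (hz k).1 hk
        filter_upwards [hcont.continuousAt.eventually_const_lt h0] with y hy _
        exact hy
      · exact Eventually.of_forall fun y h => absurd h hk
    refine eventually_nhdsWithin_iff.2 ?_
    filter_upwards [hnear, isOpen_ball.mem_nhds hyδ] with y hy hyball hfeas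
    have hle := hmin z hzδ _ hyδ (by
        rw [(hasFDerivAt_localProgramLagrangian hP i z _).fderiv]
        ext v
        have := inner_primal_kktMap (P := P) z.1 z.2 i v
        rw [hstat, inner_zero_left, sum_inner] at this
        simpa using this.symm) (by
        rintro (k | k)
        · simp [hu, hg]
        · exact hact k k.2) y hyball
    have e1 : P.localProgramLagrangian i z (primal z.1 i) =
        P.localObjective z.2 i (fun j => P.sensitivity z.2 i j) (primal z.1 i) := by
      rw [hval, Finset.sum_eq_zero (fun k _ => hcs k), hg]
      simp
    have e2 : ∑ k, ineqMult z.1 i k * P.hAt i (mixed z.2 i y) k =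
        ∑ k : {k // P.hAt i (primal p₀) k = 0},
          ineqMult z.1 i k * P.hAt i (mixed z.2 i y) k := by
      rw [← Fintype.sum_subtype_add_sum_subtype (fun k => P.hAt i (primal p₀) k = 0), add_eq_left]
      exact Finset.sum_eq_zero fun k _ => by rw [hinact k.1 k.2, zero_mul]
    have e3 : ∑ a, u a z y ^ 2 =
        ∑ k : {k // P.hAt i (primal p₀) k = 0}, P.hAt i (mixed z.2 i y) k ^ 2 := by
      simp [hu, hfeas.1]
    rw [e1, hval, e2, e3, hfeas.1, add_assoc, Finset.mul_sum, ← Finset.sum_add_distrib] at hle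
    have e4 : ∑ k : {k // P.hAt i (primal p₀) k = 0},
        (ineqMult z.1 i k * P.hAt i (mixed z.2 i y) k + c * P.hAt i (mixed z.2 i y) k ^ 2) ≤ 0 :=
      Finset.sum_nonpos fun k _ => by nlinarith [hy k.1 k.2, hfeas.2 k.1]
    simp only [PiLp.zero_apply, mul_zero, Finset.sum_const_zero, add_zero] at hle
    linarith
  · by_cases hk : P.hAt i (primal p₀) k = 0
    · exact (hact k hk).le
    · exact ((hz k).2 hk).le
  · by_cases hk : P.hAt i (primal p₀) k = 0
    · exact ((hz k).1 hk).le
    · exact (hinact k hk).ge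

end NLP

namespace NeighborAffine

/-! ### Equality of the sensitivities in neighbor-affine form -/

theorem hasFDerivAt_sum_coupling {F : Type*} [NormedAddCommGroup F] [NormedSpace ℝ F] {i j : V}
    (hji : i ∈ G.neighborSet j) (a : F) (c : ∀ l : G.neighborSet j, Vec (n l) → F)
    (x : ∀ i, Vec (n i)) (hc : DifferentiableAt ℝ (c ⟨i, hji⟩) (x i)) :
    HasFDerivAt (fun y => a + ∑ l, c l (Function.update x i y l))
      (fderiv ℝ (c ⟨i, hji⟩) (x i)) (x i) := by
  have h : ∀ l ∈ Finset.univ, HasFDerivAt (fun y => c l (Function.update x i y l))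
      (if l = ⟨i, hji⟩ then fderiv ℝ (c ⟨i, hji⟩) (x i) else 0) (x i) := by
    intro l _
    split_ifs with hl
    · subst hl
      simpa using hc.hasFDerivAt
    · have hl' : (l : V) ≠ i := fun h => hl (Subtype.ext h)
      simp only [Function.update_of_ne hl']
      exact hasFDerivAt_const _ _
  simpa using (HasFDerivAt.fun_sum h).const_add a

/-- With `x_j` fixed and `j ≠ i`, the block `x_i` enters `L_j` only through the coupling term
indexed by `i`. -/
theorem sensitivity_eq {D : NeighborAffine G n ng nh} (hD : D.IsSmooth) (p : PDVec n ng nh)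
    (i : V) (j : G.neighborSet i) : D.sensitivity p i j = D.toNLP.sensitivity p i j := by
  have hji : i ∈ G.neighborSet j := G.adj_symm j.2
  have hne : (j : V) ≠ i := (G.ne_of_adj j.2).symm
  set x := primal p with hx
  have hpart : ∀ (F : Type) [NormedAddCommGroup F] [NormedSpace ℝ F]
      (φ : Vec (n j) × Vec (n i) → F), ContDiff ℝ 3 φ →
      DifferentiableAt ℝ (fun y => φ (x j, y)) (x i) := fun F _ _ φ hφ =>
    (hφ.comp (contDiff_const.prodMk contDiff_id)).differentiable (by norm_num) _
  have hf : HasFDerivAt (fun y => D.toNLP.fAt j (Function.update x i y))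
      (fderiv ℝ (fun y => D.fCpl j ⟨i, hji⟩ (x j) y) (x i)) (x i) := by
    simp only [NLP.fAt, toNLP, Function.update_of_ne hne]
    exact hasFDerivAt_sum_coupling hji _ (fun l => D.fCpl j l (x j)) x
      (hpart _ _ (hD.fCpl j ⟨i, hji⟩))
  have hg : HasFDerivAt (fun y => D.toNLP.gAt j (Function.update x i y))
      (fderiv ℝ (fun y => D.gCpl j ⟨i, hji⟩ (x j) y) (x i)) (x i) := by
    simp only [NLP.gAt, toNLP, Function.update_of_ne hne]
    exact hasFDerivAt_sum_coupling hji _ (fun l => D.gCpl j l (x j)) x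
      (hpart _ _ (hD.gCpl j ⟨i, hji⟩))
  have hh : HasFDerivAt (fun y => D.toNLP.hAt j (Function.update x i y))
      (fderiv ℝ (fun y => D.hCpl j ⟨i, hji⟩ (x j) y) (x i)) (x i) := by
    simp only [NLP.hAt, toNLP, Function.update_of_ne hne]
    exact hasFDerivAt_sum_coupling hji _ (fun l => D.hCpl j l (x j)) x
      (hpart _ _ (hD.hCpl j ⟨i, hji⟩))
  have hL : HasFDerivAt (fun y => D.toNLP.localLagrangian j (Function.update x i y) (eqMult p j)
      (ineqMult p j)) _ (x i) :=
    (hf.add ((innerSL ℝ (eqMult p j)).hasFDerivAt.comp (x i) hg)).add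
      ((innerSL ℝ (ineqMult p j)).hasFDerivAt.comp (x i) hh)
  refine ext_inner_right ℝ fun v => ?_
  rw [NLP.sensitivity, inner_partialGradient, ← hx, hL.fderiv]
  simp [sensitivity, inner_add_left, ContinuousLinearMap.adjoint_inner_left, gradient, ← hx]

end NeighborAffine

end SBDP

end

/-! ### The iteration map and local convergence -/

theorem theorem1 {V : Type*} [Fintype V] [DecidableEq V] (G : SimpleGraph V)
    [DecidableRel G.Adj] (n ng nh : V → ℕ) (P : SBDP.NLP G n ng nh) (hP : P.IsSmooth)
    (pstar : SBDP.PDVec n ng nh) (hKKT : P.IsCentralKKT pstar)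
    (hcentral : P.CentralRegularity pstar) (hlocal : P.LocalRegularity pstar) :
    ∃ ρ > 0, ∃ r₁ > 0, ∃ Φ : SBDP.PDVec n ng nh → SBDP.PDVec n ng nh,
      -- the iteration map `Φ` near `pstar`, and its Jacobian
      Φ pstar = pstar ∧
      (∀ p ∈ Metric.closedBall pstar r₁,
        Φ p ∈ Metric.closedBall pstar ρ ∧
        P.SolvesLocal p (fun i j => P.sensitivity p i j) (Φ p) ∧
        (∀ q ∈ Metric.closedBall pstar ρ,
          (∀ i, P.IsLocalKKT p i (fun j => P.sensitivity p i j)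
            (SBDP.primal q i) (SBDP.eqMult q i) (SBDP.ineqMult q i)) → q = Φ p) ∧
        (P.matM (Φ p) p).IsInvertible ∧
        HasFDerivAt Φ (P.jacobian (Φ p) p) p) ∧
      -- local convergence
      (‖P.jacobian pstar pstar‖ < 1 →
        ∃ r > 0, r ≤ r₁ ∧ ∃ C C' : ℝ, 0 < C ∧ C < 1 ∧
          -- both algorithms can be run near `pstar` from every starting point in the ball
          (∀ p₀ ∈ Metric.closedBall pstar r,
            (∃ p : ℕ → SBDP.PDVec n ng nh, p 0 = p₀ ∧ P.IsGeneralSBDP p ∧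
              ∀ k, p (k + 1) ∈ Metric.closedBall pstar ρ) ∧
            (∀ D : SBDP.NeighborAffine G n ng nh, D.IsSmooth → D.toNLP = P →
              ∃ p : ℕ → SBDP.PDVec n ng nh, p 0 = p₀ ∧ D.IsAffineSBDP p ∧
                ∀ k, p (k + 1) ∈ Metric.closedBall pstar ρ)) ∧
          -- and every such run follows `Φ` and converges at the stated rates
          (∀ p : ℕ → SBDP.PDVec n ng nh, p 0 ∈ Metric.closedBall pstar r → P.IsSBDP p →
            (∀ k, p (k + 1) ∈ Metric.closedBall pstar ρ) →
            (∀ k, p k ∈ Metric.closedBall pstar r ∧ p (k + 1) = Φ (p k)) ∧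
            Filter.Tendsto p Filter.atTop (nhds pstar) ∧
            (∀ k, ‖p (k + 1) - pstar‖ ≤ C * ‖p k - pstar‖) ∧
            (‖P.jacobian pstar pstar‖ = 0 →
              ∀ k, ‖p (k + 1) - pstar‖ ≤ C' * ‖p k - pstar‖ ^ 2))) := by

  obtain ⟨ρ, hρ, r₁, hr₁, Φ, hΦ0, hΦc, hW, hΦ⟩ := exists_implicit_map hP.kktMap
    (SBDP.NLP.kktMap_self hP hKKT)
    (SBDP.NLP.matM_isInvertible hP hKKT hcentral.strict_compl hlocal)
    (SBDP.NLP.eventually_solvesLocal hP hKKT hcentral.strict_compl hlocal)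
  have hsolve : ∀ p ∈ closedBall pstar r₁,
      P.SolvesLocal p (fun i j => P.sensitivity p i j) (Φ p) := fun p hp =>
    hW (mk_mem_prod (hΦ p hp).1 hp) (((hΦ p hp).2.1 _ (hΦ p hp).1).2 rfl)
  have huniq : ∀ p ∈ closedBall pstar r₁, ∀ q ∈ closedBall pstar ρ,
      (∀ i, P.IsLocalKKT p i (fun j => P.sensitivity p i j)
        (SBDP.primal q i) (SBDP.eqMult q i) (SBDP.ineqMult q i)) → q = Φ p :=
    fun p hp q hq h => ((hΦ p hp).2.1 q hq).1 (SBDP.NLP.kktMap_eq_zero h)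
  refine ⟨ρ, hρ, r₁, hr₁, Φ, hΦ0, fun p hp => ⟨(hΦ p hp).1, hsolve p hp, huniq p hp,
    (hΦ p hp).2.2⟩, fun hJ => ?_⟩
  have hfd : fderiv ℝ Φ pstar = P.jacobian pstar pstar := by
    have := (hΦ pstar (mem_closedBall_self hr₁.le)).2.2.2.fderiv
    rw [hΦ0] at this
    exact this
  obtain ⟨r, hr, hrr₁, C, C', hC0, hC1, hest⟩ :=
    exists_contraction_estimate hΦc hΦ0 (hfd ▸ hJ) hr₁
  rw [hfd] at hest
  have hsub : closedBall pstar r ⊆ closedBall pstar r₁ := closedBall_subset_closedBall hrr₁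
  have hmaps : ∀ p ∈ closedBall pstar r, Φ p ∈ closedBall pstar r := fun p hp => by
    have h1 := (hest p hp).1
    rw [mem_closedBall, dist_eq_norm] at hp ⊢
    nlinarith [norm_nonneg (p - pstar)]
  have haffine : ∀ D : SBDP.NeighborAffine G n ng nh, D.IsSmooth → D.toNLP = P →
      ∀ p, (fun (i : V) (j : G.neighborSet i) => D.sensitivity p i j) =
        fun (i : V) (j : G.neighborSet i) => P.sensitivity p i j := by
    rintro D hD rfl p
    funext i j
    exact SBDP.NeighborAffine.sensitivity_eq hD p i j
  refine ⟨r, hr, hrr₁, C, C', hC0, hC1, fun p₀ hp₀ => ?_, fun p hp0 hrun hρp => ?_⟩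
  · have hiter : ∀ k, Φ^[k] p₀ ∈ closedBall pstar r := fun k => by
      induction k with
      | zero => exact hp₀
      | succ k ih => rw [Function.iterate_succ_apply']; exact hmaps _ ih
    have hstep : ∀ k, P.SolvesLocal (Φ^[k] p₀) (fun i j => P.sensitivity (Φ^[k] p₀) i j)
        (Φ^[k + 1] p₀) := fun k => by
      rw [Function.iterate_succ_apply']; exact hsolve _ (hsub (hiter k))
    have hmem : ∀ k, Φ^[k + 1] p₀ ∈ closedBall pstar ρ := fun k => by
      rw [Function.iterate_succ_apply']; exact (hΦ _ (hsub (hiter k))).1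
    refine ⟨⟨fun k => Φ^[k] p₀, rfl, hstep, hmem⟩, fun D hD hDP =>
      ⟨fun k => Φ^[k] p₀, rfl, fun k => ?_, hmem⟩⟩
    rw [haffine D hD hDP, hDP]
    exact hstep k
  · have hgen : P.IsGeneralSBDP p := by
      rcases hrun with h | ⟨D, hD, hDP, h⟩
      · exact h
      · intro k
        have := h k
        rwa [haffine D hD hDP, hDP] at this
    -- Uniqueness in the `ρ`-ball is what forces an arbitrary run to follow `Φ`; of each local
    -- solution only its KKT conditions enter.
    have hstep : ∀ k, p k ∈ closedBall pstar r → p (k + 1) = Φ (p k) := fun k hk =>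
      huniq _ (hsub hk) _ (hρp k) fun i => (hgen k i).2
    have hball : ∀ k, p k ∈ closedBall pstar r := fun k => by
      induction k with
      | zero => exact hp0
      | succ k ih => rw [hstep k ih]; exact hmaps _ ih
    have hlin : ∀ k, ‖p (k + 1) - pstar‖ ≤ C * ‖p k - pstar‖ := fun k => by
      rw [hstep k (hball k)]; exact (hest _ (hball k)).1
    refine ⟨fun k => ⟨hball k, hstep k (hball k)⟩, ?_, hlin, fun hz k => ?_⟩
    · have hgeo : ∀ k, ‖p k - pstar‖ ≤ C ^ k * ‖p 0 - pstar‖ := fun k => by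
        induction k with
        | zero => simp
        | succ k ih =>
          refine (hlin k).trans ?_
          rw [pow_succ', mul_assoc]
          exact mul_le_mul_of_nonneg_left ih hC0.le
      rw [tendsto_iff_norm_sub_tendsto_zero]
      refine squeeze_zero (fun k => norm_nonneg _) hgeo ?_
      simpa using (tendsto_pow_atTop_nhds_zero_of_lt_one hC0.le hC1).mul_const ‖p 0 - pstar‖
    · rw [hstep k (hball k)]
      exact (hest _ (hball k)).2 hz
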